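/- Let $n\ge 1$, let $X$ be a locally compact Hausdorff space, and let $\mathbb{Z}_n=\mathbb{Z}/n\mathbb{Z}$ act freely on $X$ by homeomorphisms, with generator $h\colon X\to X$. Let $C_0(X)$ be the C*-algebra of continuous complex functions on $X$ vanishing at infinity (so $C_0(X)=C(X)$ if $X$ is compact), and let $\mathbb{Z}$ act on $C_0(X)$ through the automorphism $\alpha(f)=f\circ h^{-1}$. Then the (full) crossed product $A=C_0(X)\rtimes_\alpha\mathbb{Z}$ is a locally trivial $n$-homogeneous C*-algebra with spectrum $X/\mathbb{Z}_n\times\mathbb{T}$. That is: (1) every irreducible representation of $A$ on a Hilbert space has dimension $n$, and there are a locally trivial bundle $E$ over the spectrum $\widehat{A}$, with fibre $M_n(\mathbb{C})$ and structure group the $*$-automorphisms of $M_n(\mathbb{C})$, and a $*$-isomorphism of $A$ onto the algebra of continuous sections of $E$ vanishing at infinity, under which, for every $\sigma\in\widehat{A}$, the kernel of the evaluation of sections at $\sigma$ is the kernel of $\sigma$; (2) $\widehat{A}$, the set of unitary equivalence classes of irreducible representations of $A$ with the hull-kernel topology, is homeomorphic to $X/\mathbb{Z}_n\times\mathbb{T}$,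 where $X/\mathbb{Z}_n$ is the orbit space with the quotient topology and $\mathbb{T}$ is the unit circle. -/

import Mathlib

open scoped ZeroAtInfty ENNReal Topology

universe u v w

noncomputable section

/-! ### Crossed products by a single automorphism -/

section CrossedProduct

variable {A : Type u} [NonUnitalCStarAlgebra A]

/-- A covariant representation of the C*-dynamical system `(A, ℤ, k ↦ α ^ k)`: a *-representation
`π` of `A` on a Hilbert space together with a unitary `U` such that `U π(a) U* = π(α(a))`. -/
structure CovariantRep (α : A ≃⋆ₐ[ℂ] A) : Type (u + 1) where
  H : Type u
  [normedAddCommGroup : NormedAddCommGroup H]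
  [innerProductSpace : InnerProductSpace ℂ H]
  [completeSpace : CompleteSpace H]
  π : A →⋆ₙₐ[ℂ] (H →L[ℂ] H)
  U : unitary (H →L[ℂ] H)
  covariant : ∀ a : A, (U : H →L[ℂ] H) * π a * star (U : H →L[ℂ] H) = π (α a)

attribute [instance] CovariantRep.normedAddCommGroup CovariantRep.innerProductSpace
  CovariantRep.completeSpace

/-- The ambient C*-algebra of the universal covariant representation: bounded families of
operators, one on the space of each covariant representation. -/
abbrev CovariantRep.Ambient (α : A ≃⋆ₐ[ℂ] A) : Type (u + 1) :=
  lp (fun ρ : CovariantRep α => ρ.H →L[ℂ] ρ.H) ∞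

/-- The image of `a u ^ k` (an element of the algebraic crossed product) in the universal covariant
representation; its component at `(π, U)` is `π(a) U ^ k`. -/
def CovariantRep.monomial (α : A ≃⋆ₐ[ℂ] A) (a : A) (k : ℤ) : CovariantRep.Ambient α :=
  ⟨fun ρ => ρ.π a * ((ρ.U ^ k : unitary (ρ.H →L[ℂ] ρ.H)) : ρ.H →L[ℂ] ρ.H), by
    refine memℓp_infty ⟨‖a‖, ?_⟩
    rintro _ ⟨ρ, rfl⟩
    calc ‖ρ.π a * ((ρ.U ^ k : unitary (ρ.H →L[ℂ] ρ.H)) : ρ.H →L[ℂ] ρ.H)‖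
        = ‖ρ.π a‖ := CStarRing.norm_mul_coe_unitary _ _
      _ ≤ ‖a‖ := NonUnitalStarAlgHom.norm_apply_le ρ.π a⟩

/-- The (full) crossed product `A ⋊_α ℤ`: the C*-algebra generated by the elements `a u ^ k` in the
universal covariant representation. Equivalently, the completion of the algebraic crossed product
in the norm `‖∑ a_k u ^ k‖ = sup ‖∑ π(a_k) U ^ k‖`, over all covariant representations `(π, U)`. -/
def crossedProduct (α : A ≃⋆ₐ[ℂ] A) : NonUnitalStarSubalgebra ℂ (CovariantRep.Ambient α) :=
  (NonUnitalStarAlgebra.adjoin ℂ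
    {x | ∃ (a : A) (k : ℤ), x = CovariantRep.monomial α a k}).topologicalClosure

instance (α : A ≃⋆ₐ[ℂ] A) : NonUnitalCStarAlgebra (crossedProduct α) :=
  NonUnitalStarSubalgebra.nonUnitalCStarAlgebra (crossedProduct α)
    (h_closed := NonUnitalStarSubalgebra.isClosed_topologicalClosure _)

end CrossedProduct

/-- The automorphism `f ↦ f ∘ h⁻¹` of `C₀(X)` induced by a homeomorphism `h` of `X`. -/
def Homeomorph.c0Aut {X : Type u} [TopologicalSpace X] (h : X ≃ₜ X) : C₀(X, ℂ) ≃⋆ₐ[ℂ] C₀(X, ℂ) where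
  toFun f := f.comp h.symm.toCocompactMap
  invFun f := f.comp h.toCocompactMap
  left_inv f := by ext x; exact congrArg f (h.symm_apply_apply x)
  right_inv f := by ext x; exact congrArg f (h.apply_symm_apply x)
  map_mul' _ _ := rfl
  map_add' _ _ := rfl
  map_star' _ := rfl
  map_smul' _ _ := rfl

/-! ### Irreducible representations and the spectrum -/

section Spectrum

/-- A (nonzero, topologically) irreducible *-representation of a C*-algebra on a Hilbert space. -/
structure IrreducibleRep (A : Type v) [NonUnitalCStarAlgebra A] : Type (max v (w + 1)) where
  H : Type w
  [normedAddCommGroup : NormedAddCommGroup H]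
  [innerProductSpace : InnerProductSpace ℂ H]
  [completeSpace : CompleteSpace H]
  π : A →⋆ₙₐ[ℂ] (H →L[ℂ] H)
  ne_zero : ∃ a, π a ≠ 0
  irreducible : ∀ K : Submodule ℂ H, IsClosed (K : Set H) → (∀ a, ∀ ξ ∈ K, π a ξ ∈ K) →
    K = ⊥ ∨ K = ⊤

attribute [instance] IrreducibleRep.normedAddCommGroup IrreducibleRep.innerProductSpace
  IrreducibleRep.completeSpace

variable (A : Type v) [NonUnitalCStarAlgebra A]

/-- Unitary equivalence of irreducible representations. -/
instance IrreducibleRep.setoid : Setoid (IrreducibleRep.{v, w} A) where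
  r ρ σ := ∃ V : ρ.H ≃ₗᵢ[ℂ] σ.H, ∀ a ξ, V (ρ.π a ξ) = σ.π a (V ξ)
  iseqv :=
    { refl := fun ρ => ⟨LinearIsometryEquiv.refl ℂ ρ.H, fun _ _ => rfl⟩
      symm := by
        rintro ρ σ ⟨V, hV⟩
        refine ⟨V.symm, fun a ξ => V.injective ?_⟩
        rw [hV, V.apply_symm_apply, V.apply_symm_apply]
      trans := by
        rintro ρ σ τ ⟨V, hV⟩ ⟨W, hW⟩
        refine ⟨V.trans W, fun a ξ => ?_⟩
        change W (V _) = τ.π a (W (V ξ))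
        rw [hV, hW] }

/-- The spectrum of a C*-algebra: the set of unitary equivalence classes of its irreducible
representations (on Hilbert spaces in the universe `w`). -/
def CStarSpectrum : Type (max v (w + 1)) := Quotient (IrreducibleRep.setoid.{v, w} A)

variable {A}

/-- The kernel of (any representative of) a class of irreducible representations. -/
def CStarSpectrum.ker (σ : CStarSpectrum.{v, w} A) : TwoSidedIdeal A :=
  Quotient.lift (fun ρ : IrreducibleRep.{v, w} A => TwoSidedIdeal.ker ρ.π) (by
    rintro ρ σ ⟨V, hV⟩
    ext a
    rw [TwoSidedIdeal.mem_ker, TwoSidedIdeal.mem_ker]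
    constructor
    · intro h
      ext ξ
      have := hV a (V.symm ξ)
      rw [h, V.apply_symm_apply] at this
      simpa using this.symm
    · intro h
      ext ξ
      apply V.injective
      rw [hV, h]
      simp) σ

/-- The hull-kernel (Jacobson) topology: the open sets are the sets `{[π] | ¬ I ⊆ ker π}` for
two-sided ideals `I`, that is, the sets pulled back along `[π] ↦ ker π` from the lower topology. -/
instance : TopologicalSpace (CStarSpectrum.{v, w} A) :=
  TopologicalSpace.induced CStarSpectrum.ker (Topology.lower (TwoSidedIdeal A))

end Spectrum

/-! ### Locally trivial bundles of matrix algebras -/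

/-- A locally trivial bundle over `Y` with fibre the C*-algebra `M_n(ℂ)` and structure group
`Aut(M_n(ℂ))`, given by its transition functions on an open cover of `Y` indexed by `ι`. -/
structure MatrixBundle (ι : Type v) (Y : Type w) [TopologicalSpace Y] (n : ℕ) extends
    FiberBundleCore ι Y (Matrix (Fin n) (Fin n) ℂ) where
  coordChange_starAlg : ∀ i j, ∀ y ∈ baseSet i ∩ baseSet j,
    ∃ φ : Matrix (Fin n) (Fin n) ℂ ≃⋆ₐ[ℂ] Matrix (Fin n) (Fin n) ℂ, ∀ a, φ a = coordChange i j y a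

namespace MatrixBundle

variable {ι : Type v} {Y : Type w} [TopologicalSpace Y] {n : ℕ} (E : MatrixBundle ι Y n)

/-- A map `s` selecting a point in each fibre is a continuous map into the total space.
(The fibre over `y` is identified with `M_n(ℂ)` by the chart with index `indexAt y`.) -/
def IsContinuousSection (s : Y → Matrix (Fin n) (Fin n) ℂ) : Prop :=
  Continuous (fun y => (⟨y, s y⟩ : E.toFiberBundleCore.TotalSpace))

/-- Continuity of a section, read in the charts. -/
theorem isContinuousSection_iff (s : Y → Matrix (Fin n) (Fin n) ℂ) :
    E.IsContinuousSection s ↔ ∀ y₀, ContinuousAt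
      (fun y => E.coordChange (E.indexAt y) (E.indexAt y₀) y (s y)) y₀ := by
  unfold IsContinuousSection
  rw [continuous_iff_continuousAt]
  refine forall_congr' fun y₀ => ?_
  rw [FiberBundle.continuousAt_totalSpace]
  exact ⟨fun h => h.2, fun h => ⟨continuousAt_id, h⟩⟩

/-- The coordinate change from the preferred chart at `y` to the one at `y₀` is a
*-automorphism, for `y` close to `y₀`. -/
theorem eventually_starAlg (y₀ : Y) : ∀ᶠ y in 𝓝 y₀,
    ∃ φ : Matrix (Fin n) (Fin n) ℂ ≃⋆ₐ[ℂ] Matrix (Fin n) (Fin n) ℂ,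
      ∀ a, φ a = E.coordChange (E.indexAt y) (E.indexAt y₀) y a := by
  filter_upwards [(E.isOpen_baseSet (E.indexAt y₀)).mem_nhds (E.mem_baseSet_at y₀)] with y hy
  exact E.coordChange_starAlg _ _ y ⟨E.mem_baseSet_at y, hy⟩

/-- The *-algebra `Γ₀(E)` of continuous sections of `E` that vanish at infinity, with the fibrewise
operations. (All norms on the fibre define the same topology, so vanishing at infinity in the
topology of `M_n(ℂ)` is vanishing at infinity of the C*-norm.) -/
def sections : NonUnitalStarSubalgebra ℂ (Y → Matrix (Fin n) (Fin n) ℂ) where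
  carrier := {s | E.IsContinuousSection s ∧ Filter.Tendsto s (Filter.cocompact Y) (𝓝 0)}
  add_mem' := by
    rintro s t ⟨hs, hs'⟩ ⟨ht, ht'⟩
    refine ⟨?_, by simpa using! hs'.add ht'⟩
    rw [isContinuousSection_iff] at hs ht ⊢
    intro y₀
    refine ((hs y₀).add (ht y₀)).congr ?_
    filter_upwards [E.eventually_starAlg y₀] with y ⟨φ, hφ⟩
    simp [← hφ]
  zero_mem' := by
    refine ⟨?_, tendsto_const_nhds⟩
    rw [isContinuousSection_iff]
    intro y₀
    refine (continuousAt_const (y := (0 : Matrix (Fin n) (Fin n) ℂ))).congr ?_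
    filter_upwards [E.eventually_starAlg y₀] with y ⟨φ, hφ⟩
    simp [← hφ]
  mul_mem' := by
    rintro s t ⟨hs, hs'⟩ ⟨ht, ht'⟩
    refine ⟨?_, by simpa using! hs'.mul ht'⟩
    rw [isContinuousSection_iff] at hs ht ⊢
    intro y₀
    refine ((hs y₀).mul (ht y₀)).congr ?_
    filter_upwards [E.eventually_starAlg y₀] with y ⟨φ, hφ⟩
    simp [← hφ]
  smul_mem' := by
    rintro c s ⟨hs, hs'⟩
    refine ⟨?_, by simpa using! hs'.const_smul c⟩
    rw [isContinuousSection_iff] at hs ⊢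
    intro y₀
    refine ((hs y₀).const_smul c).congr ?_
    filter_upwards [E.eventually_starAlg y₀] with y ⟨φ, hφ⟩
    simp [← hφ]
  star_mem' := by
    rintro s ⟨hs, hs'⟩
    refine ⟨?_, by simpa using! hs'.star⟩
    rw [isContinuousSection_iff] at hs ⊢
    intro y₀
    refine ((hs y₀).star).congr ?_
    filter_upwards [E.eventually_starAlg y₀] with y ⟨φ, hφ⟩
    simp [← hφ, map_star]

end MatrixBundle

/-- `A` is `n`-homogeneous: all its irreducible representations have dimension `n`. -/
def IsHomogeneousCStarAlgebra (n : ℕ) (A : Type v) [NonUnitalCStarAlgebra A] : Prop :=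
  ∀ ρ : IrreducibleRep.{v, w} A, Module.Finite ℂ ρ.H ∧ Module.finrank ℂ ρ.H = n

/-- `A` is a locally trivial `n`-homogeneous C*-algebra: it is `n`-homogeneous, and it is isomorphic
to the algebra `Γ₀(E)` of a locally trivial bundle `E` of matrix algebras `M_n(ℂ)` over the spectrum
of `A`, in such a way that evaluation of sections at `σ` has the same kernel as the class `σ`. -/
def IsLocallyTrivialHomogeneous (n : ℕ) (A : Type v) [NonUnitalCStarAlgebra A] : Prop :=
  IsHomogeneousCStarAlgebra.{v, w} n A ∧
    ∃ (ι : Type (max v (w + 1))) (E : MatrixBundle ι (CStarSpectrum.{v, w} A) n)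
      (Ψ : A ≃⋆ₐ[ℂ] E.sections),
      ∀ (a : A) (σ : CStarSpectrum.{v, w} A),
        (Ψ a : CStarSpectrum.{v, w} A → Matrix (Fin n) (Fin n) ℂ) σ = 0 ↔ a ∈ σ.ker

end

/-! A point `(x, z)` of `X × 𝕋` gives a covariant representation on `ℂ ^ n`: functions act
diagonally by their values along the orbit of `x`, and the unitary is the cyclic shift `W` weighted
so that `W ^ n = z`. Together these define a transform `evHom` from the crossed product to `C₀(X ×
𝕋, M_n(ℂ))`. Moving `x` along its orbit by `k` conjugates the value by `W ^ k`. The core of the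
proof is that `evHom` is an isomorphism onto all functions with this equivariance
(`isEquivariantTransform_evHom`); the rest concerns only the algebra of equivariant functions.

Injectivity (`evHom_injective`) comes from the gauge action `u ↦ t u`. In any covariant
representation, the mean over `t` retains only the zeroth Fourier coefficient `f ∈ C₀(X)`. The same
`f` is the mean over `z` of the corner entry at `(x, z)`. So if all point evaluations of `a` vanish,
the mean of `star a * a` is zero in every covariant representation, which forces `a = 0`.

Surjectivity (`exists_evHom_eq`): the range is closed. An equivariant function is a sum of `n` terms
`diag(g) W ^ k`, where `g` is a scalar function read along orbits. By Stone–Weierstrass `g` is a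
uniform limit of sums of `φ(x) z ^ m`, and `diag(φ) z ^ m W ^ k = diag(φ) W ^ (k + m n)` is a
transform.

For the spectrum, continuous functions on the one-point compactification of `X/ℤ_n × 𝕋` act as
central multipliers. Irreducibility makes the annihilator of a representation a closed prime ideal,
hence the ideal of a single point, which is not infinity (`exists_ker_le`). Freeness makes
evaluation at a point surjective onto `M_n(ℂ)`, so the representation is equivalent to that
evaluation. The maps from `X × 𝕋` to the spectrum and to `X/ℤ_n × 𝕋` are then open quotient maps
with the same fibres.

For the bundle, the free action of a finite group makes the quotient map a local homeomorphism. Its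
local inverses trivialize the bundle, with transition maps conjugation by locally constant powers of
`W`; its sections are exactly the equivariant functions (`bijective_sectionHom`). -/

set_option linter.unusedSectionVars false

noncomputable section

/-! ### Weighted cyclic shifts -/

section CyclicShift

variable {n : ℕ}

/-- The `k`-th power of the weighted cyclic shift `e_0 ↦ e_1 ↦ ⋯ ↦ e_{n-1} ↦ z e_0`. -/
def cyclicShift (n : ℕ) (z : Circle) (k : ℤ) : Matrix (Fin n) (Fin n) ℂ :=
  Matrix.of fun i j =>
    if (n : ℤ) ∣ k + j - i then ((z ^ ((k + j - i) / (n : ℤ)) : Circle) : ℂ) else 0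

theorem cyclicShift_apply (z : Circle) (k : ℤ) (i j : Fin n) :
    cyclicShift n z k i j =
      if (n : ℤ) ∣ k + j - i then ((z ^ ((k + j - i) / (n : ℤ)) : Circle) : ℂ) else 0 := rfl

theorem Fin.eq_of_intCast_dvd_sub {i j : Fin n} (h : (n : ℤ) ∣ (j : ℤ) - i) : i = j := by
  have hi := i.isLt
  have hj := j.isLt
  have := Int.eq_zero_of_abs_lt_dvd h (by rw [abs_lt]; omega)
  exact Fin.ext (by omega)

theorem Fin.exists_intCast_dvd [NeZero n] (k : ℤ) : ∃ j : Fin n, (n : ℤ) ∣ k + j := by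
  have hn : (0 : ℤ) < n := by exact_mod_cast Nat.pos_of_ne_zero (NeZero.ne n)
  have h0 := Int.emod_nonneg (-k) hn.ne'
  have h1 := Int.emod_lt_of_pos (-k) hn
  refine ⟨⟨((-k) % n).toNat, by omega⟩, ?_⟩
  simp only [Int.toNat_of_nonneg h0]
  have := Int.emod_add_mul_ediv (-k) n
  exact ⟨-(-k / n), by linear_combination this⟩

theorem cyclicShift_zero (z : Circle) : cyclicShift n z 0 = 1 := by
  ext i j
  rw [cyclicShift_apply, Matrix.one_apply]
  by_cases hij : i = j
  · subst hij; simp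
  · rw [if_neg, if_neg hij]
    intro h
    exact hij (Fin.eq_of_intCast_dvd_sub (by simpa using h))

/-- Each row of the first factor has exactly one nonzero entry, so the product has one term. The
exponents of `z` count passages through `0`; they add because the divisions are exact. -/
theorem cyclicShift_add [NeZero n] (z : Circle) (k l : ℤ) :
    cyclicShift n z (k + l) = cyclicShift n z k * cyclicShift n z l := by
  ext i m
  rw [Matrix.mul_apply]
  obtain ⟨j₀, hj₀⟩ := Fin.exists_intCast_dvd (n := n) (k - i)
  have hj₀' : (n : ℤ) ∣ k + j₀ - i := by convert hj₀ using 1; ring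
  have hn : (n : ℤ) ≠ 0 := by exact_mod_cast NeZero.ne n
  rw [Finset.sum_eq_single j₀]
  · simp only [cyclicShift_apply, if_pos hj₀']
    have key : k + l + m - i = (k + j₀ - i) + (l + m - j₀) := by ring
    by_cases h : (n : ℤ) ∣ l + m - j₀
    · rw [if_pos h, if_pos (key ▸ dvd_add hj₀' h), key, Int.add_ediv_of_dvd_left hj₀', zpow_add,
        Circle.coe_mul]
    · rw [if_neg h, if_neg, mul_zero]
      rw [key]
      exact fun h' => h ((dvd_add_right hj₀').1 h')
  · intro j _ hj
    rw [cyclicShift_apply, if_neg, zero_mul]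
    intro h
    refine hj (Fin.eq_of_intCast_dvd_sub ?_).symm
    exact (dvd_sub h hj₀').trans (dvd_of_eq (by ring))
  · simp

theorem star_cyclicShift (z : Circle) (k : ℤ) :
    star (cyclicShift n z k) = cyclicShift n z (-k) := by
  ext i j
  rw [Matrix.star_apply, cyclicShift_apply, cyclicShift_apply]
  have key : -k + j - i = -(k + i - j) := by ring
  simp only [key, dvd_neg]
  split_ifs with h
  · rw [Int.neg_ediv_of_dvd h, zpow_neg, Circle.coe_inv_eq_conj]; rfl
  · simp

/-- The `n`-th power of the shift is the scalar `z`. This lets powers of `z` be absorbed into powers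
of `u`, and makes conjugation depend only on residues mod `n`. -/
theorem cyclicShift_mul_natCast [NeZero n] (z : Circle) (k q : ℤ) :
    cyclicShift n z (k + q * n) = ((z ^ q : Circle) : ℂ) • cyclicShift n z k := by
  ext i j
  have hn : (n : ℤ) ≠ 0 := by exact_mod_cast NeZero.ne n
  have key : k + q * n + j - i = (k + j - i) + q * n := by ring
  rw [Matrix.smul_apply, cyclicShift_apply, cyclicShift_apply, key, smul_eq_mul]
  simp only [dvd_add_left (Dvd.intro_left q rfl : (n : ℤ) ∣ q * n)]
  split_ifs with h
  · rw [Int.add_mul_ediv_right _ _ hn, zpow_add, Circle.coe_mul, mul_comm]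
  · simp

theorem cyclicShift_mul_neg [NeZero n] (z : Circle) (k : ℤ) :
    cyclicShift n z k * cyclicShift n z (-k) = 1 := by
  rw [← cyclicShift_add, add_neg_cancel, cyclicShift_zero]

theorem cyclicShift_neg_mul [NeZero n] (z : Circle) (k : ℤ) :
    cyclicShift n z (-k) * cyclicShift n z k = 1 := by
  rw [← cyclicShift_add, neg_add_cancel, cyclicShift_zero]

theorem cyclicShift_apply_zero_natCast [NeZero n] (z : Circle) (i j : Fin n) :
    cyclicShift n z ((i : ℕ) : ℤ) j 0 = if j = i then 1 else 0 := by
  rw [cyclicShift_apply]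
  simp only [Fin.val_zero, Nat.cast_zero, add_zero]
  split_ifs with h h' h'
  · subst h'; simp
  · exact absurd (Fin.eq_of_intCast_dvd_sub h) h'
  · subst h'; simp at h
  · rfl

theorem continuous_cyclicShift (k : ℤ) : Continuous fun z : Circle => cyclicShift n z k := by
  refine continuous_matrix fun i j => ?_
  simp only [cyclicShift_apply]
  split_ifs
  · exact continuous_subtype_val.comp (continuous_zpow _)
  · exact continuous_const

/-- The weighted cyclic shift as a unitary matrix. -/
def cyclicShiftUnitary (n : ℕ) [NeZero n] (z : Circle) : unitary (Matrix (Fin n) (Fin n) ℂ) :=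
  ⟨cyclicShift n z 1, by
    rw [Unitary.mem_iff, star_cyclicShift]
    exact ⟨cyclicShift_neg_mul z 1, cyclicShift_mul_neg z 1⟩⟩

theorem coe_cyclicShiftUnitary_zpow [NeZero n] (z : Circle) (k : ℤ) :
    ((cyclicShiftUnitary n z ^ k : unitary (Matrix (Fin n) (Fin n) ℂ)) :
      Matrix (Fin n) (Fin n) ℂ) = cyclicShift n z k := by
  have h1 : ((cyclicShiftUnitary n z : unitary (Matrix (Fin n) (Fin n) ℂ)) :
      Matrix (Fin n) (Fin n) ℂ) = cyclicShift n z 1 := rfl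
  induction k with
  | zero => simp [cyclicShift_zero]
  | succ k ih => rw [zpow_add_one, Submonoid.coe_mul, ih, h1, cyclicShift_add]
  | pred k ih =>
    rw [zpow_sub_one, Submonoid.coe_mul, ih, ← Unitary.star_eq_inv, Unitary.coe_star, h1,
      star_cyclicShift, ← cyclicShift_add, sub_eq_add_neg]

/-- Every matrix is a combination of powers of the weighted cyclic shift with diagonal
coefficients. -/
theorem eq_sum_diagonal_mul_cyclicShift [NeZero n] (z : Circle) (M : Matrix (Fin n) (Fin n) ℂ) :
    M = ∑ k : Fin n, Matrix.diagonal (fun i => (M * cyclicShift n z (-((k : ℕ) : ℤ))) i i) *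
      cyclicShift n z ((k : ℕ) : ℤ) := by
  ext i j
  rw [Matrix.sum_apply]
  simp only [Matrix.diagonal_mul]
  -- The residue `k₀ ≡ i - j` is the only power whose `(i, j)` entry is nonzero.
  obtain ⟨k₀, hk₀⟩ := Fin.exists_intCast_dvd (n := n) (j - i)
  have hk₀' : (n : ℤ) ∣ (k₀ : ℕ) + j - i := by convert hk₀ using 1; ring
  have hneg : -((k₀ : ℕ) : ℤ) + i - j = -(((k₀ : ℕ) : ℤ) + j - i) := by ring
  rw [Finset.sum_eq_single k₀]
  · rw [Matrix.mul_apply, Finset.sum_eq_single j]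
    · rw [cyclicShift_apply, cyclicShift_apply, if_pos hk₀', hneg, if_pos ((dvd_neg).2 hk₀'),
        Int.neg_ediv_of_dvd hk₀', mul_assoc, ← Circle.coe_mul, ← zpow_add]
      simp
    · intro l _ hl
      rw [cyclicShift_apply, if_neg, mul_zero]
      intro h
      refine hl (Fin.eq_of_intCast_dvd_sub ?_).symm
      exact (dvd_neg.2 (dvd_add h hk₀')).trans (dvd_of_eq (by ring))
    · simp
  · intro k _ hk
    rw [cyclicShift_apply z ((k : ℕ) : ℤ) i j, if_neg, mul_zero]
    intro h
    refine hk (Fin.eq_of_intCast_dvd_sub ?_).symm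
    exact (dvd_sub h hk₀').trans (dvd_of_eq (by ring))
  · simp

end CyclicShift

/-- The generated algebra is spanned by products of elements of `s` and their adjoints, and these
already lie in `s`. Serves both for the monomials `a u ^ k` and for the functions `φ(x) z ^ m`. -/
theorem NonUnitalStarAlgebra.adjoin_subset_span_of_mul_mem_of_star_mem {R : Type u} {A : Type v}
    [CommSemiring R] [StarRing R] [NonUnitalSemiring A] [StarRing A] [Module R A]
    [IsScalarTower R A A] [SMulCommClass R A A] [StarModule R A] {s : Set A}
    (hmul : ∀ x ∈ s, ∀ y ∈ s, x * y ∈ s) (hstar : ∀ x ∈ s, star x ∈ s) :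
    (NonUnitalStarAlgebra.adjoin R s : Set A) ⊆ Submodule.span R s := by
  intro x hx
  have hx' : x ∈ (NonUnitalStarAlgebra.adjoin R s).toSubmodule := hx
  rw [NonUnitalStarAlgebra.adjoin_eq_span] at hx'
  refine Submodule.span_mono (fun y hy => ?_) hx'
  induction hy using Subsemigroup.closure_induction with
  | mem y hy => exact hy.elim id fun h => by simpa using hstar _ h
  | mul y z _ _ hy hz => exact hmul y hy z hz

/-! ### The span of the monomials in the crossed product -/

section CrossedProductSpan

variable {A : Type u} [NonUnitalCStarAlgebra A] {α : A ≃⋆ₐ[ℂ] A}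

instance CovariantRep.Ambient.instModule : Module ℂ (CovariantRep.Ambient α) :=
  lp.instModuleSubtypePreLpMemAddSubgroup

instance CovariantRep.Ambient.instSMul : SMul ℂ (CovariantRep.Ambient α) :=
  DistribMulAction.toDistribSMul.toSMul

/-- The component of a family of operators at a covariant representation. -/
def CovariantRep.coordHom (ρ : CovariantRep α) :
    CovariantRep.Ambient α →⋆ₙₐ[ℂ] (ρ.H →L[ℂ] ρ.H) where
  toFun b := b ρ
  map_smul' _ _ := rfl
  map_zero' := rfl
  map_add' _ _ := rfl
  map_mul' _ _ := rfl
  map_star' _ := rfl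

theorem CovariantRep.coordHom_monomial (ρ : CovariantRep α) (a : A) (k : ℤ) :
    ρ.coordHom (CovariantRep.monomial α a k) =
      ρ.π a * ((ρ.U ^ k : unitary (ρ.H →L[ℂ] ρ.H)) : ρ.H →L[ℂ] ρ.H) := rfl

theorem CovariantRep.norm_coordHom_le (ρ : CovariantRep α) (b : CovariantRep.Ambient α) :
    ‖ρ.coordHom b‖ ≤ ‖b‖ :=
  lp.norm_apply_le_norm ENNReal.top_ne_zero b ρ

theorem CovariantRep.continuous_coordHom (ρ : CovariantRep α) : Continuous ρ.coordHom :=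
  AddMonoidHomClass.continuous_of_bound ρ.coordHom 1 fun b => by
    simpa using ρ.norm_coordHom_le b

theorem CovariantRep.Ambient.ext_coordHom {b c : CovariantRep.Ambient α}
    (h : ∀ ρ : CovariantRep α, ρ.coordHom b = ρ.coordHom c) : b = c :=
  Subtype.ext (funext h)

theorem CovariantRep.U_mul (ρ : CovariantRep α) (a : A) :
    (ρ.U : ρ.H →L[ℂ] ρ.H) * ρ.π a = ρ.π (α a) * ρ.U := by
  rw [← ρ.covariant a, mul_assoc, Unitary.coe_star_mul_self, mul_one]

-- The witness is `α ^ k` applied to `a`. It does not depend on `ρ`, so the relation holds for the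
-- whole universal family at once.
variable (α) in
theorem CovariantRep.exists_U_zpow_mul (a : A) (k : ℤ) : ∃ b : A, ∀ ρ : CovariantRep α,
    ((ρ.U ^ k : unitary (ρ.H →L[ℂ] ρ.H)) : ρ.H →L[ℂ] ρ.H) * ρ.π a =
      ρ.π b * ((ρ.U ^ k : unitary (ρ.H →L[ℂ] ρ.H)) : ρ.H →L[ℂ] ρ.H) := by
  induction k with
  | zero => exact ⟨a, fun ρ => by simp⟩
  | succ k ih =>
    obtain ⟨b, hb⟩ := ih
    refine ⟨α b, fun ρ => ?_⟩
    rw [add_comm, zpow_one_add, Submonoid.coe_mul, mul_assoc, hb, ← mul_assoc, ρ.U_mul, mul_assoc]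
  | pred k ih =>
    obtain ⟨b, hb⟩ := ih
    refine ⟨α.symm b, fun ρ => ?_⟩
    have h := ρ.U_mul (α.symm b)
    rw [α.apply_symm_apply] at h
    have h2 : star (ρ.U : ρ.H →L[ℂ] ρ.H) * ρ.π b = ρ.π (α.symm b) * star (ρ.U : ρ.H →L[ℂ] ρ.H) := by
      calc star (ρ.U : ρ.H →L[ℂ] ρ.H) * ρ.π b
          = star (ρ.U : ρ.H →L[ℂ] ρ.H) * (ρ.π b * ρ.U) * star (ρ.U : ρ.H →L[ℂ] ρ.H) := by
            rw [mul_assoc, mul_assoc, Unitary.mul_star_self_of_mem ρ.U.2, mul_one]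
        _ = _ := by rw [← h, ← mul_assoc, Unitary.coe_star_mul_self, one_mul]
    rw [sub_eq_add_neg, add_comm, zpow_add, zpow_neg_one, Submonoid.coe_mul, mul_assoc, hb,
      ← mul_assoc, ← Unitary.star_eq_inv, Unitary.coe_star, h2, mul_assoc]

variable (α) in
/-- The span of the monomials `a u ^ k`. -/
def monomialSpan : Submodule ℂ (CovariantRep.Ambient α) :=
  Submodule.span ℂ {x | ∃ (a : A) (k : ℤ), x = CovariantRep.monomial α a k}

theorem exists_monomial_mul_monomial (a b : A) (k l : ℤ) : ∃ (c : A) (m : ℤ),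
    CovariantRep.monomial α a k * CovariantRep.monomial α b l = CovariantRep.monomial α c m := by
  obtain ⟨c, hc⟩ := CovariantRep.exists_U_zpow_mul α b k
  refine ⟨a * c, k + l, CovariantRep.Ambient.ext_coordHom fun ρ => ?_⟩
  rw [map_mul, ρ.coordHom_monomial, ρ.coordHom_monomial, ρ.coordHom_monomial, map_mul, zpow_add,
    Submonoid.coe_mul, mul_assoc, ← mul_assoc _ (ρ.π b), hc]
  simp only [mul_assoc]

theorem exists_star_monomial (a : A) (k : ℤ) : ∃ (c : A) (m : ℤ),
    star (CovariantRep.monomial α a k) = CovariantRep.monomial α c m := by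
  obtain ⟨c, hc⟩ := CovariantRep.exists_U_zpow_mul α (star a) (-k)
  refine ⟨c, -k, CovariantRep.Ambient.ext_coordHom fun ρ => ?_⟩
  rw [map_star, ρ.coordHom_monomial, ρ.coordHom_monomial, star_mul, ← hc, zpow_neg,
    ← Unitary.star_eq_inv, Unitary.coe_star, map_star]

theorem adjoin_monomial_le_monomialSpan :
    (NonUnitalStarAlgebra.adjoin ℂ
      {x | ∃ (a : A) (k : ℤ), x = CovariantRep.monomial α a k} : Set (CovariantRep.Ambient α)) ⊆
      monomialSpan α := by
  refine NonUnitalStarAlgebra.adjoin_subset_span_of_mul_mem_of_star_mem ?_ ?_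
  · rintro _ ⟨a, k, rfl⟩ _ ⟨b, l, rfl⟩
    exact exists_monomial_mul_monomial a b k l
  · rintro _ ⟨a, k, rfl⟩
    exact exists_star_monomial a k

theorem monomial_mem_crossedProduct (a : A) (k : ℤ) :
    CovariantRep.monomial α a k ∈ crossedProduct α :=
  NonUnitalStarSubalgebra.le_topologicalClosure _
    (NonUnitalStarAlgebra.subset_adjoin ℂ _ ⟨a, k, rfl⟩)

theorem mem_closure_monomialSpan {x : CovariantRep.Ambient α} (hx : x ∈ crossedProduct α) :
    x ∈ closure (monomialSpan α : Set (CovariantRep.Ambient α)) :=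
  closure_mono adjoin_monomial_le_monomialSpan hx

/-- A closed linear condition that holds for the monomials holds on the crossed product. -/
theorem crossedProduct_induction {S : Submodule ℂ (CovariantRep.Ambient α)}
    (hS : IsClosed (S : Set (CovariantRep.Ambient α)))
    (h : ∀ a k, CovariantRep.monomial α a k ∈ S) {x : CovariantRep.Ambient α}
    (hx : x ∈ crossedProduct α) : x ∈ S := by
  have hle : monomialSpan α ≤ S := Submodule.span_le.2 (by rintro _ ⟨a, k, rfl⟩; exact h a k)
  exact closure_minimal hle hS (mem_closure_monomialSpan hx)

end CrossedProductSpan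

/-! ### The point representations -/

section PointRep

open scoped Matrix.Norms.L2Operator

/-- Matrices acting on the Hilbert space `ℂ ^ n` in a given universe. -/
def matrixCLM (n : ℕ) : Matrix (Fin n) (Fin n) ℂ ≃⋆ₐ[ℂ]
    (EuclideanSpace ℂ (ULift.{w} (Fin n)) →L[ℂ] EuclideanSpace ℂ (ULift.{w} (Fin n))) :=
  (StarAlgEquiv.ofAlgEquiv (Matrix.reindexAlgEquiv ℂ ℂ Equiv.ulift.symm)
    (fun M => (Matrix.conjTranspose_reindex Equiv.ulift.symm Equiv.ulift.symm M).symm)).trans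
    Matrix.toEuclideanCLM

theorem matrixCLM_apply (n : ℕ) (M : Matrix (Fin n) (Fin n) ℂ)
    (v : EuclideanSpace ℂ (ULift.{w} (Fin n))) (i : ULift.{w} (Fin n)) :
    matrixCLM.{w} n M v i = ∑ j : ULift.{w} (Fin n), M i.down j.down * v j := by
  rfl

/-- The action of matrices on `ℂ ^ n`, as a homomorphism. -/
def matrixHom (n : ℕ) : Matrix (Fin n) (Fin n) ℂ →⋆ₙₐ[ℂ]
    (EuclideanSpace ℂ (ULift.{w} (Fin n)) →L[ℂ] EuclideanSpace ℂ (ULift.{w} (Fin n))) where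
  toFun := matrixCLM n
  map_smul' := map_smul (matrixCLM n)
  map_zero' := map_zero (matrixCLM n)
  map_add' := map_add (matrixCLM n)
  map_mul' := map_mul (matrixCLM n)
  map_star' := map_star (matrixCLM n)

/-- The matrix of an operator on `ℂ ^ n`, as a homomorphism. -/
def matrixHomSymm (n : ℕ) :
    (EuclideanSpace ℂ (ULift.{w} (Fin n)) →L[ℂ] EuclideanSpace ℂ (ULift.{w} (Fin n))) →⋆ₙₐ[ℂ]
    Matrix (Fin n) (Fin n) ℂ where
  toFun := (matrixCLM n).symm
  map_smul' := map_smul (matrixCLM n).symm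
  map_zero' := map_zero (matrixCLM n).symm
  map_add' := map_add (matrixCLM n).symm
  map_mul' := map_mul (matrixCLM n).symm
  map_star' := (matrixCLM n).symm.map_star'

/-- The action of matrices on `ℂ ^ n`, as a homomorphism of *-monoids. -/
def matrixStarMonoidHom (n : ℕ) : Matrix (Fin n) (Fin n) ℂ →⋆*
    (EuclideanSpace ℂ (ULift.{w} (Fin n)) →L[ℂ] EuclideanSpace ℂ (ULift.{w} (Fin n))) where
  toFun := matrixCLM n
  map_one' := map_one (matrixCLM n)
  map_mul' := map_mul (matrixCLM n)
  map_star' := map_star (matrixCLM n)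

variable {n : ℕ} [NeZero n] {X : Type u} [TopologicalSpace X] [AddAction (ZMod n) X]
  [ContinuousConstVAdd (ZMod n) X]

variable (n X) in
/-- The automorphism of `C₀(X)` induced by the generator of `ℤ/n`. -/
abbrev c0Rot : C₀(X, ℂ) ≃⋆ₐ[ℂ] C₀(X, ℂ) := (Homeomorph.vadd (1 : ZMod n) : X ≃ₜ X).c0Aut

theorem c0Rot_apply (f : C₀(X, ℂ)) (x : X) : c0Rot n X f x = f ((-1 : ZMod n) +ᵥ x) := rfl

/-- Functions as diagonal matrices, by evaluation along an orbit. -/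
def diagHom (x : X) : C₀(X, ℂ) →⋆ₙₐ[ℂ] Matrix (Fin n) (Fin n) ℂ where
  toFun f := Matrix.diagonal fun i => f (((i : ℕ) : ZMod n) +ᵥ x)
  map_smul' c f := by ext i j; simp [Matrix.diagonal_apply]
  map_zero' := by ext i j; simp [Matrix.diagonal_apply]
  map_add' f g := by ext i j; by_cases h : i = j <;> simp [h]
  map_mul' f g := by simp
  map_star' f := by
    ext i j
    by_cases h : i = j
    · subst h; simp
    · simp [h, Ne.symm h]

theorem diagHom_apply (x : X) (f : C₀(X, ℂ)) :
    diagHom x f = Matrix.diagonal fun i : Fin n => f (((i : ℕ) : ZMod n) +ᵥ x) := rfl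

/-- A nonzero `(i, j)` entry of the shift has `j + k ≡ i` mod `n`, so the column value at `j + k`
and the row value at `i` of `f` agree. Both covariance and equivariance come from this. -/
theorem diagHom_vadd_intCast (x : X) (z : Circle) (k : ℤ) (f : C₀(X, ℂ)) :
    cyclicShift n z k * diagHom ((k : ZMod n) +ᵥ x) f = diagHom x f * cyclicShift n z k := by
  ext i j
  rw [diagHom_apply, diagHom_apply, Matrix.mul_diagonal, Matrix.diagonal_mul, cyclicShift_apply]
  split_ifs with h
  · have h' : ((j : ℕ) : ZMod n) + (k : ZMod n) = ((i : ℕ) : ZMod n) := by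
      have := (ZMod.intCast_zmod_eq_zero_iff_dvd _ n).2 h
      push_cast at this
      linear_combination this
    rw [vadd_vadd, h', mul_comm]
  · simp

/-- The covariant representation of `(C₀(X), ℤ)` on `ℂ ^ n` attached to a point of `X` and a
point of the circle. -/
def pointRep (p : X × Circle) : CovariantRep (c0Rot n X) where
  H := EuclideanSpace ℂ (ULift.{u} (Fin n))
  π := (matrixHom.{u} n).comp (diagHom p.1)
  U := Unitary.map (matrixStarMonoidHom.{u} n) (cyclicShiftUnitary n p.2)
  covariant f := by
    -- Starting at the translate by `-1` makes the shift by `1` return to `p.1`; evaluation at that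
    -- translate is evaluation of `f ∘ h⁻¹` at `p.1`.
    have h := diagHom_vadd_intCast (n := n) ((-1 : ZMod n) +ᵥ p.1) p.2 1 f
    simp only [Int.cast_one, vadd_vadd, add_neg_cancel, zero_vadd] at h
    have h' : diagHom (n := n) ((-1 : ZMod n) +ᵥ p.1) f = diagHom p.1 (c0Rot n X f) := by
      ext i j
      rw [diagHom_apply, diagHom_apply]
      simp only [c0Rot_apply, vadd_vadd, add_comm]
    change matrixCLM n (cyclicShift n p.2 1) * matrixCLM n (diagHom p.1 f) *
      star (matrixCLM n (cyclicShift n p.2 1)) = matrixCLM n (diagHom p.1 (c0Rot n X f))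
    rw [← map_star, ← map_mul, ← map_mul, h, h', star_cyclicShift, mul_assoc, cyclicShift_mul_neg,
      mul_one]

variable (n) in
/-- The matrix of a family of operators at a point representation. -/
def evAmbient (p : X × Circle) :
    CovariantRep.Ambient (c0Rot n X) →⋆ₙₐ[ℂ] Matrix (Fin n) (Fin n) ℂ :=
  (matrixHomSymm.{u} n).comp (pointRep p).coordHom

theorem evAmbient_monomial (p : X × Circle) (f : C₀(X, ℂ)) (k : ℤ) :
    evAmbient n p (CovariantRep.monomial (c0Rot n X) f k) =
      diagHom p.1 f * cyclicShift n p.2 k := by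
  change (matrixCLM n).symm (matrixCLM n (diagHom p.1 f) *
    ((Unitary.map (matrixStarMonoidHom.{u} n) (cyclicShiftUnitary n p.2) ^ k : unitary _) : _)) = _
  rw [← map_zpow, Unitary.coe_map, coe_cyclicShiftUnitary_zpow]
  change (matrixCLM n).symm (matrixCLM n _ * matrixCLM n _) = _
  rw [← map_mul, StarAlgEquiv.symm_apply_apply]

theorem norm_evAmbient_le (p : X × Circle) (b : CovariantRep.Ambient (c0Rot n X)) :
    ‖evAmbient n p b‖ ≤ ‖b‖ :=
  (NonUnitalStarAlgHom.norm_apply_le (matrixHomSymm.{u} n) _).trans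
    ((pointRep p).norm_coordHom_le b)

theorem continuous_evAmbient (p : X × Circle) :
    Continuous (evAmbient n p : CovariantRep.Ambient (c0Rot n X) → _) :=
  AddMonoidHomClass.continuous_of_bound (evAmbient n p) 1 fun b => by
    simpa using norm_evAmbient_le p b

theorem norm_mul_cyclicShift (M : Matrix (Fin n) (Fin n) ℂ) (z : Circle) (k : ℤ) :
    ‖M * cyclicShift n z k‖ = ‖M‖ := by
  rw [← coe_cyclicShiftUnitary_zpow]
  exact CStarRing.norm_mul_coe_unitary _ _

theorem norm_cyclicShift_mul (M : Matrix (Fin n) (Fin n) ℂ) (z : Circle) (k : ℤ) :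
    ‖cyclicShift n z k * M‖ = ‖M‖ := by
  rw [← coe_cyclicShiftUnitary_zpow]
  exact CStarRing.norm_coe_unitary_mul _ _

theorem tendsto_fst_cocompact_of_compactSpace (X Y : Type*) [TopologicalSpace X]
    [TopologicalSpace Y] [CompactSpace Y] :
    Filter.Tendsto (Prod.fst : X × Y → X) (Filter.cocompact _) (Filter.cocompact _) := by
  refine Filter.hasBasis_cocompact.tendsto_right_iff.2 fun K hK => ?_
  filter_upwards [(hK.prod isCompact_univ).compl_mem_cocompact] with p hp hp'
  exact hp ⟨hp', Set.mem_univ _⟩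

variable (n X) in
/-- The families of operators whose matrices at the point representations depend continuously
on the point and vanish at infinity. -/
def c0EvSubmodule : Submodule ℂ (CovariantRep.Ambient (c0Rot n X)) where
  carrier := {b | Continuous (fun p => evAmbient n p b) ∧
    Filter.Tendsto (fun p => evAmbient n p b) (Filter.cocompact (X × Circle)) (𝓝 0)}
  add_mem' := by
    rintro a b ⟨ha, ha'⟩ ⟨hb, hb'⟩
    simp only [Set.mem_ofPred_eq, map_add]
    exact ⟨ha.add hb, by simpa using! ha'.add hb'⟩
  zero_mem' := by
    simp only [Set.mem_ofPred_eq, map_zero]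
    exact ⟨continuous_const, tendsto_const_nhds⟩
  smul_mem' := by
    rintro c b ⟨hb, hb'⟩
    simp only [Set.mem_ofPred_eq, map_smul]
    exact ⟨hb.const_smul c, by simpa using! hb'.const_smul c⟩

/-- Evaluations are contractive uniformly in the point, so norm limits give uniform limits of matrix
functions. -/
theorem isClosed_c0EvSubmodule :
    IsClosed (c0EvSubmodule n X : Set (CovariantRep.Ambient (c0Rot n X))) := by
  refine isClosed_of_closure_subset fun b hb => ?_
  have key : ∀ ε > 0, ∃ c ∈ c0EvSubmodule n X, ∀ p, dist (evAmbient n p b) (evAmbient n p c) < ε := by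
    intro ε hε
    obtain ⟨c, hc, hbc⟩ := Metric.mem_closure_iff.1 hb ε hε
    refine ⟨c, hc, fun p => ?_⟩
    rw [dist_eq_norm, ← map_sub]
    exact (norm_evAmbient_le p _).trans_lt (by rwa [← dist_eq_norm])
  constructor
  · refine continuous_of_uniform_approx_of_continuous fun s hs => ?_
    obtain ⟨ε, hε, hs⟩ := Metric.mem_uniformity_dist.1 hs
    obtain ⟨c, hc, h⟩ := key ε hε
    exact ⟨_, hc.1, fun p => hs (h p)⟩
  · rw [Metric.tendsto_nhds]
    intro ε hε
    obtain ⟨c, hc, h⟩ := key (ε / 2) (half_pos hε)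
    filter_upwards [Metric.tendsto_nhds.1 hc.2 (ε / 2) (half_pos hε)] with p hp
    calc _ ≤ _ := dist_triangle _ (evAmbient n p c) _
      _ < ε := by linarith [h p]

theorem monomial_mem_c0EvSubmodule (f : C₀(X, ℂ)) (k : ℤ) :
    CovariantRep.monomial (c0Rot n X) f k ∈ c0EvSubmodule n X := by
  have hcont : Continuous fun p : X × Circle => (diagHom p.1 f : Matrix (Fin n) (Fin n) ℂ) := by
    refine Continuous.matrix_diagonal (continuous_pi fun i => ?_)
    exact (map_continuous f).comp ((continuous_const_vadd _).comp continuous_fst)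
  constructor
  · simp only [evAmbient_monomial]
    exact hcont.matrix_mul ((continuous_cyclicShift k).comp continuous_snd)
  · simp only [evAmbient_monomial]
    -- The unitary factor does not change the norm, so only the decay of `f` along the `n`
    -- translates matters.
    rw [tendsto_zero_iff_norm_tendsto_zero]
    simp only [norm_mul_cyclicShift]
    rw [← tendsto_zero_iff_norm_tendsto_zero]
    have h0 : (0 : Matrix (Fin n) (Fin n) ℂ) = Matrix.diagonal 0 := by simp
    rw [h0]
    refine ((Continuous.matrix_diagonal continuous_id).tendsto (0 : Fin n → ℂ)).comp ?_
    rw [tendsto_pi_nhds]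
    intro i
    exact ((zero_at_infty f).comp (Homeomorph.vadd (((i : ℕ) : ZMod n)) :
      X ≃ₜ X).isClosedEmbedding.tendsto_cocompact).comp
        (tendsto_fst_cocompact_of_compactSpace X Circle)

/-- Point representations on one orbit are intertwined by powers of the shift. The relation is
linear and closed, so monomials suffice. -/
theorem evAmbient_vadd {b : CovariantRep.Ambient (c0Rot n X)}
    (hb : b ∈ crossedProduct (c0Rot n X)) (x : X) (z : Circle) (k : ℤ) :
    evAmbient n ((k : ZMod n) +ᵥ x, z) b =
      cyclicShift n z (-k) * evAmbient n (x, z) b * cyclicShift n z k := by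
  let S : Submodule ℂ (CovariantRep.Ambient (c0Rot n X)) :=
    { carrier := {b | evAmbient n ((k : ZMod n) +ᵥ x, z) b =
        cyclicShift n z (-k) * evAmbient n (x, z) b * cyclicShift n z k}
      add_mem' := by
        intro a b ha hb
        simp only [Set.mem_ofPred_eq] at ha hb ⊢
        rw [map_add, map_add, ha, hb, mul_add, add_mul]
      zero_mem' := by simp
      smul_mem' := by
        intro c b hb
        simp only [Set.mem_ofPred_eq] at hb ⊢
        rw [map_smul, map_smul, hb, mul_smul_comm, smul_mul_assoc] }
  refine crossedProduct_induction (S := S) ?_ (fun f l => ?_) hb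
  · exact isClosed_eq (continuous_evAmbient _)
      ((continuous_const.mul (continuous_evAmbient _)).mul continuous_const)
  · change _ = _
    rw [evAmbient_monomial, evAmbient_monomial]
    have h := diagHom_vadd_intCast (n := n) x z k f
    calc diagHom (n := n) ((k : ZMod n) +ᵥ x) f * cyclicShift n z l
        = cyclicShift n z (-k) * (cyclicShift n z k * diagHom ((k : ZMod n) +ᵥ x) f) *
            cyclicShift n z l := by
          rw [← mul_assoc, cyclicShift_neg_mul, one_mul]
      _ = _ := by
          rw [h]
          simp only [mul_assoc, ← cyclicShift_add, add_comm k l]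

/-- The Gelfand-type transform of the crossed product: the function of the matrices at the point
representations. -/
def evHom : crossedProduct (c0Rot n X) →⋆ₙₐ[ℂ] C₀(X × Circle, Matrix (Fin n) (Fin n) ℂ) where
  toFun a :=
    have h := crossedProduct_induction isClosed_c0EvSubmodule monomial_mem_c0EvSubmodule a.2
    ⟨⟨fun p => evAmbient n p a, h.1⟩, h.2⟩
  map_smul' c a := by ext1 p; exact (evAmbient n p).map_smul' _ _
  map_zero' := by ext1 p; exact (evAmbient n p).map_zero'
  map_add' a b := by ext1 p; exact (evAmbient n p).map_add' _ _
  map_mul' a b := by ext1 p; exact (evAmbient n p).map_mul' _ _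
  map_star' a := by ext1 p; exact (evAmbient n p).map_star' _

theorem evHom_apply (a : crossedProduct (c0Rot n X)) (p : X × Circle) :
    evHom a p = evAmbient n p (a : CovariantRep.Ambient (c0Rot n X)) := rfl

theorem evHom_vadd (a : crossedProduct (c0Rot n X)) (x : X) (z : Circle) (k : ℤ) :
    evHom a ((k : ZMod n) +ᵥ x, z) =
      cyclicShift n z (-k) * evHom a (x, z) * cyclicShift n z k :=
  evAmbient_vadd a.2 x z k

end PointRep

/-! ### Gauge automorphisms and faithfulness of the point representations -/

section Gauge

variable {A : Type u} [NonUnitalCStarAlgebra A] {α : A ≃⋆ₐ[ℂ] A}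

theorem Unitary.coe_smul_zpow {H : Type*} [NormedAddCommGroup H] [InnerProductSpace ℂ H]
    [CompleteSpace H] (t : Circle) {U V : unitary (H →L[ℂ] H)}
    (h : (V : H →L[ℂ] H) = (t : ℂ) • (U : H →L[ℂ] H)) (k : ℤ) :
    ((V ^ k : unitary (H →L[ℂ] H)) : H →L[ℂ] H) =
      ((t ^ k : Circle) : ℂ) • ((U ^ k : unitary (H →L[ℂ] H)) : H →L[ℂ] H) := by
  induction k with
  | zero => simp
  | succ k ih =>
    rw [zpow_add_one, zpow_add_one, zpow_add_one, Submonoid.coe_mul, Submonoid.coe_mul, ih, h,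
      smul_mul_smul_comm, Circle.coe_mul]
  | pred k ih =>
    rw [zpow_sub_one, zpow_sub_one, zpow_sub_one, Submonoid.coe_mul, Submonoid.coe_mul, ih,
      ← Unitary.star_eq_inv, ← Unitary.star_eq_inv, Unitary.coe_star, Unitary.coe_star, h,
      star_smul, smul_mul_smul_comm, Circle.coe_mul, Circle.coe_inv_eq_conj]
    rfl

/-- Multiplying the unitary of a covariant representation by a scalar of modulus one. -/
abbrev CovariantRep.gauge (ρ : CovariantRep α) (t : Circle) : CovariantRep α where
  H := ρ.H
  π := ρ.π
  U := ⟨(t : ℂ) • (ρ.U : ρ.H →L[ℂ] ρ.H), by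
    have ht : star (t : ℂ) * t = 1 := by
      rw [← Circle.coe_one, ← inv_mul_cancel t, Circle.coe_mul, Circle.coe_inv_eq_conj]; rfl
    rw [Unitary.mem_iff, star_smul, smul_mul_smul_comm, smul_mul_smul_comm,
      Unitary.coe_star_mul_self, Unitary.mul_star_self_of_mem ρ.U.2, mul_comm (t : ℂ), ht, one_smul]
    exact ⟨rfl, rfl⟩⟩
  covariant a := by
    have ht : (t : ℂ) * star (t : ℂ) = 1 := by
      rw [← Circle.coe_one, ← mul_inv_cancel t, Circle.coe_mul, Circle.coe_inv_eq_conj]; rfl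
    change ((t : ℂ) • (ρ.U : ρ.H →L[ℂ] ρ.H)) * _ * star ((t : ℂ) • (ρ.U : ρ.H →L[ℂ] ρ.H)) = _
    rw [star_smul, smul_mul_assoc, smul_mul_smul_comm, ht, one_smul, ρ.covariant]

/-- The component of a family of operators at a gauged covariant representation. -/
def CovariantRep.gaugeHom (ρ : CovariantRep α) (t : Circle) :
    CovariantRep.Ambient α →⋆ₙₐ[ℂ] (ρ.H →L[ℂ] ρ.H) := (ρ.gauge t).coordHom

theorem CovariantRep.gaugeHom_monomial (ρ : CovariantRep α) (t : Circle) (a : A) (k : ℤ) :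
    ρ.gaugeHom t (CovariantRep.monomial α a k) = ((t ^ k : Circle) : ℂ) •
      ρ.coordHom (CovariantRep.monomial α a k) := by
  rw [ρ.coordHom_monomial]
  refine ((ρ.gauge t).coordHom_monomial a k).trans ?_
  rw [Unitary.coe_smul_zpow t (U := ρ.U) rfl]
  exact mul_smul_comm _ _ _

theorem CovariantRep.norm_gaugeHom_le (ρ : CovariantRep α) (t : Circle)
    (b : CovariantRep.Ambient α) : ‖ρ.gaugeHom t b‖ ≤ ‖b‖ :=
  (ρ.gauge t).norm_coordHom_le b

theorem Circle.continuous_coe_zpow (k : ℤ) : Continuous fun t : Circle => ((t ^ k : Circle) : ℂ) :=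
  have h : Continuous ((↑) : Circle → ℂ) := continuous_subtype_val
  h.comp (continuous_zpow k)

/-- Uniformly bounded families of linear maps that are continuous on the monomials are continuous
on the crossed product. -/
theorem continuous_of_mem_crossedProduct {T V : Type*} [TopologicalSpace T]
    [SeminormedAddCommGroup V] [NormedSpace ℂ V] {φ : T → CovariantRep.Ambient α → V}
    (hadd : ∀ t b c, φ t (b + c) = φ t b + φ t c) (hsmul : ∀ t (r : ℂ) b, φ t (r • b) = r • φ t b)
    (hφ : ∀ t b, ‖φ t b‖ ≤ ‖b‖)
    (hmon : ∀ a k, Continuous fun t => φ t (CovariantRep.monomial α a k))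
    {b : CovariantRep.Ambient α} (hb : b ∈ crossedProduct α) : Continuous fun t => φ t b := by
  have hspan : ∀ c ∈ monomialSpan α, Continuous fun t => φ t c := by
    intro c hc
    induction hc using Submodule.span_induction with
    | mem c hc => obtain ⟨a, k, rfl⟩ := hc; exact hmon a k
    | zero =>
      have : ∀ t, φ t 0 = 0 := fun t => by simpa using hsmul t 0 0
      simpa [this] using continuous_const
    | add c d _ _ hc hd =>
      have h : (fun t => φ t (c + d)) = (fun t => φ t c) + fun t => φ t d :=
        funext fun t => hadd t c d
      rw [h]; exact hc.add hd
    | smul r c _ hc =>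
      have h : (fun t => φ t (r • c)) = r • fun t => φ t c := funext fun t => hsmul t r c
      rw [h]; exact hc.const_smul r
  refine continuous_of_uniform_approx_of_continuous fun s hs => ?_
  obtain ⟨ε, hε, hs⟩ := Metric.mem_uniformity_dist.1 hs
  obtain ⟨c, hc, hbc⟩ := Metric.mem_closure_iff.1 (mem_closure_monomialSpan (α := α) hb) ε hε
  refine ⟨fun t => φ t c, hspan c hc, fun t => hs ?_⟩
  have hsub : φ t b - φ t c = φ t (b - c) := by
    have h := hadd t (b - c) c
    rw [sub_add_cancel] at h
    rw [h, add_sub_cancel_right]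
  rw [dist_eq_norm, hsub]
  exact (hφ t _).trans_lt (by rwa [← dist_eq_norm])

theorem CovariantRep.continuous_gaugeHom (ρ : CovariantRep α) {b : CovariantRep.Ambient α}
    (hb : b ∈ crossedProduct α) : Continuous fun t => ρ.gaugeHom t b := by
  refine continuous_of_mem_crossedProduct (φ := fun t b => ρ.gaugeHom t b)
    (fun t => (ρ.gaugeHom t).map_add') (fun t => (ρ.gaugeHom t).map_smul') ρ.norm_gaugeHom_le
    (fun a k => ?_) hb
  simp only [ρ.gaugeHom_monomial]
  exact (Circle.continuous_coe_zpow k).smul continuous_const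

/-- The gauged representation at `1` is formally another index of the family, so the two components
are compared on monomials and extended by density. -/
theorem CovariantRep.gaugeHom_one (ρ : CovariantRep α) {b : CovariantRep.Ambient α}
    (hb : b ∈ crossedProduct α) : ρ.gaugeHom 1 b = ρ.coordHom b := by
  let S : Submodule ℂ (CovariantRep.Ambient α) :=
    { carrier := {b | ρ.gaugeHom 1 b = ρ.coordHom b}
      add_mem' := fun {b c} hb hc => ((ρ.gaugeHom 1).map_add' b c).trans
        ((congrArg₂ (· + ·) hb hc).trans (ρ.coordHom.map_add' b c).symm)
      zero_mem' := (ρ.gaugeHom 1).map_zero'.trans ρ.coordHom.map_zero'.symm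
      smul_mem' := fun r b hb => ((ρ.gaugeHom 1).map_smul' r b).trans
        ((congrArg (r • ·) hb).trans (ρ.coordHom.map_smul' r b).symm) }
  refine crossedProduct_induction (S := S) ?_ (fun a k => ?_) hb
  · exact isClosed_eq (ρ.gauge 1).continuous_coordHom ρ.continuous_coordHom
  · change _ = _
    rw [ρ.gaugeHom_monomial]
    simp

theorem integral_circle_zpow (k : ℤ) :
    ∫ θ in (0 : ℝ)..2 * Real.pi, ((Circle.exp θ ^ k : Circle) : ℂ) =
      if k = 0 then 2 * Real.pi else 0 := by
  split_ifs with h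
  · subst h; simp
  · have h1 : ∀ θ : ℝ, ((Circle.exp θ ^ k : Circle) : ℂ) = Complex.exp ((k * Complex.I) * θ) := by
      intro θ
      rw [Circle.coe_zpow, Circle.coe_exp, ← Complex.exp_int_mul]
      congr 1; ring
    simp only [h1]
    rw [integral_exp_mul_complex (by simpa using h)]
    have h2 : (k * Complex.I) * ((2 * Real.pi : ℝ) : ℂ) = k * (2 * Real.pi * Complex.I) := by
      push_cast; ring
    rw [h2, Complex.exp_int_mul_two_pi_mul_I]
    simp

end Gauge

/-! ### Faithfulness of the point representations by averaging over the circle -/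

section Faithful

open scoped Matrix.Norms.L2Operator InnerProductSpace

theorem Matrix.norm_entry_le_l2_opNorm {m n : Type*} [Fintype m] [Fintype n] [DecidableEq n]
    (M : Matrix m n ℂ) (i : m) (j : n) : ‖M i j‖ ≤ ‖M‖ := by
  have h := M.l2_opNorm_mulVec (EuclideanSpace.single j (1 : ℂ))
  rw [PiLp.norm_single, norm_one, mul_one] at h
  refine le_trans ?_ ((PiLp.norm_apply_le _ i).trans h)
  simp

variable {n : ℕ} [NeZero n] {X : Type u} [TopologicalSpace X] [AddAction (ZMod n) X]
  [ContinuousConstVAdd (ZMod n) X]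

theorem mem_crossedProduct_of_mem_monomialSpan {A : Type u} [NonUnitalCStarAlgebra A]
    {α : A ≃⋆ₐ[ℂ] A} {b : CovariantRep.Ambient α} (hb : b ∈ monomialSpan α) :
    b ∈ crossedProduct α := by
  have h : monomialSpan α ≤ (crossedProduct α).toSubmodule :=
    Submodule.span_le.2 (by rintro _ ⟨a, k, rfl⟩; exact monomial_mem_crossedProduct a k)
  exact h hb

theorem continuous_inner_gaugeHom {A : Type u} [NonUnitalCStarAlgebra A]
    {α : A ≃⋆ₐ[ℂ] A} (ρ : CovariantRep α) (ξ : ρ.H) {b : CovariantRep.Ambient α}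
    (hb : b ∈ crossedProduct α) :
    Continuous fun θ : ℝ => ⟪ξ, ρ.gaugeHom (Circle.exp θ) b ξ⟫_ℂ :=
  Continuous.inner continuous_const
    (((ρ.continuous_gaugeHom hb).comp Circle.exp.continuous).clm_apply continuous_const)

theorem continuous_evAmbient_exp {b : CovariantRep.Ambient (c0Rot n X)}
    (hb : b ∈ crossedProduct (c0Rot n X)) (x : X) :
    Continuous fun θ : ℝ => evAmbient n (x, Circle.exp θ) b 0 0 :=
  have h := (crossedProduct_induction isClosed_c0EvSubmodule monomial_mem_c0EvSubmodule hb).1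
  (h.comp (Continuous.prodMk continuous_const Circle.exp.continuous)).matrix_elem 0 0

/-- The zeroth Fourier coefficient of a polynomial in the unitary `u`. -/
theorem exists_fourierCoeff {b : CovariantRep.Ambient (c0Rot n X)}
    (hb : b ∈ monomialSpan (c0Rot n X)) : ∃ f : C₀(X, ℂ),
      (∀ (ρ : CovariantRep (c0Rot n X)) (ξ : ρ.H),
        ∫ θ in (0 : ℝ)..2 * Real.pi, ⟪ξ, ρ.gaugeHom (Circle.exp θ) b ξ⟫_ℂ =
          2 * Real.pi * ⟪ξ, ρ.π f ξ⟫_ℂ) ∧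
      ∀ x, ∫ θ in (0 : ℝ)..2 * Real.pi, evAmbient n (x, Circle.exp θ) b 0 0 =
        2 * Real.pi * f x := by
  induction hb using Submodule.span_induction with
  | mem b hb =>
    obtain ⟨a, k, rfl⟩ := hb
    refine ⟨if k = 0 then a else 0, fun ρ ξ => ?_, fun x => ?_⟩
    · simp only [ρ.gaugeHom_monomial, smul_apply, inner_smul_right]
      rw [intervalIntegral.integral_mul_const, integral_circle_zpow, ρ.coordHom_monomial]
      split_ifs with h
      · subst h; simp
      · simp
    · simp only [evAmbient_monomial, diagHom_apply, Matrix.diagonal_mul, cyclicShift_apply,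
        add_sub_cancel_right]
      -- The corner entry of the `k`-th power is `z ^ (k / n)` if `n ∣ k` and `0` otherwise, so its
      -- mean over the circle vanishes unless `k = 0`.
      by_cases h : (n : ℤ) ∣ k
      · simp only [if_pos h]
        have hk : k / n = 0 ↔ k = 0 := by
          obtain ⟨c, rfl⟩ := h
          have hn : (n : ℤ) ≠ 0 := by exact_mod_cast NeZero.ne n
          rw [Int.mul_ediv_cancel_left _ hn]
          exact ⟨fun h => by rw [h, mul_zero], fun h => (mul_eq_zero.1 h).resolve_left hn⟩
        rw [intervalIntegral.integral_const_mul, integral_circle_zpow]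
        simp only [hk]
        split_ifs <;> simp [mul_comm]
      · have hk : k ≠ 0 := by rintro rfl; simp at h
        simp [h, hk]
  | zero =>
    refine ⟨0, fun ρ ξ => ?_, fun x => ?_⟩
    · have h : ∀ t, ρ.gaugeHom t 0 = 0 := fun t => (ρ.gaugeHom t).map_zero'
      have h' : ρ.π 0 = 0 := ρ.π.map_zero'
      simp [h, h']
    · have h : ∀ p, evAmbient n p (0 : CovariantRep.Ambient (c0Rot n X)) = 0 :=
        fun p => (evAmbient n p).map_zero'
      simp [h]
  | add b c hb hc ihb ihc =>
    obtain ⟨f, hf, hf'⟩ := ihb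
    obtain ⟨g, hg, hg'⟩ := ihc
    have hb := mem_crossedProduct_of_mem_monomialSpan hb
    have hc := mem_crossedProduct_of_mem_monomialSpan hc
    refine ⟨f + g, fun ρ ξ => ?_, fun x => ?_⟩
    · have h : ∀ t, ρ.gaugeHom t (b + c) = ρ.gaugeHom t b + ρ.gaugeHom t c :=
        fun t => (ρ.gaugeHom t).map_add' b c
      have h' : ρ.π (f + g) = ρ.π f + ρ.π g := ρ.π.map_add' f g
      simp only [h, h', add_apply, inner_add_right]
      rw [intervalIntegral.integral_add
        ((continuous_inner_gaugeHom ρ ξ hb).intervalIntegrable _ _)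
        ((continuous_inner_gaugeHom ρ ξ hc).intervalIntegrable _ _), hf, hg, mul_add]
    · have h : ∀ p, evAmbient n p (b + c) = evAmbient n p b + evAmbient n p c :=
        fun p => (evAmbient n p).map_add' b c
      simp only [h, Matrix.add_apply]
      rw [intervalIntegral.integral_add
        ((continuous_evAmbient_exp hb x).intervalIntegrable _ _)
        ((continuous_evAmbient_exp hc x).intervalIntegrable _ _), hf', hg',
        ZeroAtInftyContinuousMap.add_apply, mul_add]
  | smul r b _ ih =>
    obtain ⟨f, hf, hf'⟩ := ih
    refine ⟨r • f, fun ρ ξ => ?_, fun x => ?_⟩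
    · have h : ∀ t, ρ.gaugeHom t (r • b) = r • ρ.gaugeHom t b :=
        fun t => (ρ.gaugeHom t).map_smul' r b
      have h' : ρ.π (r • f) = r • ρ.π f := ρ.π.map_smul' r f
      simp only [h, h', smul_apply, inner_smul_right]
      rw [intervalIntegral.integral_const_mul, hf]
      ring
    · have h : ∀ p, evAmbient n p (r • b) = r • evAmbient n p b :=
        fun p => (evAmbient n p).map_smul' r b
      simp only [h, Matrix.smul_apply, smul_eq_mul]
      rw [intervalIntegral.integral_const_mul, hf', ZeroAtInftyContinuousMap.smul_apply, smul_eq_mul]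
      ring

/-- The Fourier coefficient `f` is the mean of corner entries of point evaluations, so `‖f‖ ≤ C`,
and `ρ.π` is contractive. Thus point representations control the gauge mean in every covariant
representation. -/
theorem norm_integral_gaugeHom_le {b : CovariantRep.Ambient (c0Rot n X)}
    (hb : b ∈ monomialSpan (c0Rot n X)) {C : ℝ} (hC : 0 ≤ C) (h : ∀ p, ‖evAmbient n p b‖ ≤ C)
    (ρ : CovariantRep (c0Rot n X)) (ξ : ρ.H) :
    ‖∫ θ in (0 : ℝ)..2 * Real.pi, ⟪ξ, ρ.gaugeHom (Circle.exp θ) b ξ⟫_ℂ‖ ≤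
      2 * Real.pi * (C * ‖ξ‖ ^ 2) := by
  obtain ⟨f, hf, hf'⟩ := exists_fourierCoeff hb
  have h2π : ‖(2 * Real.pi : ℂ)‖ = 2 * Real.pi := by
    simp [abs_of_pos Real.pi_pos]
  have hfC : ‖f‖ ≤ C := by
    rw [← ZeroAtInftyContinuousMap.norm_toBCF_eq_norm,
      BoundedContinuousFunction.norm_le hC]
    intro x
    have h1 := intervalIntegral.norm_integral_le_of_norm_le_const (a := 0) (b := 2 * Real.pi)
      (f := fun θ : ℝ => evAmbient n (x, Circle.exp θ) b 0 0) (C := C)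
      (fun θ _ => (Matrix.norm_entry_le_l2_opNorm _ 0 0).trans (h _))
    rw [hf', norm_mul, h2π, sub_zero, abs_of_pos Real.two_pi_pos, mul_comm C] at h1
    exact le_of_mul_le_mul_left h1 Real.two_pi_pos
  rw [hf, norm_mul, h2π]
  refine mul_le_mul_of_nonneg_left ?_ Real.two_pi_pos.le
  calc ‖⟪ξ, ρ.π f ξ⟫_ℂ‖ ≤ ‖ξ‖ * ‖ρ.π f ξ‖ := norm_inner_le_norm _ _
    _ ≤ ‖ξ‖ * (C * ‖ξ‖) := by
        gcongr
        exact (ContinuousLinearMap.le_opNorm _ _).trans (mul_le_mul_of_nonneg_right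
          ((NonUnitalStarAlgHom.norm_apply_le ρ.π f).trans hfC) (norm_nonneg _))
    _ = _ := by ring

theorem integral_gaugeHom_eq_zero {b : CovariantRep.Ambient (c0Rot n X)}
    (hb : b ∈ crossedProduct (c0Rot n X)) (h : ∀ p, evAmbient n p b = 0)
    (ρ : CovariantRep (c0Rot n X)) (ξ : ρ.H) :
    ∫ θ in (0 : ℝ)..2 * Real.pi, ⟪ξ, ρ.gaugeHom (Circle.exp θ) b ξ⟫_ℂ = 0 := by
  rw [← norm_le_zero_iff]
  refine le_of_forall_pos_le_add fun δ hδ => ?_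
  -- A polynomial `c` within `ε` of `b` has evaluations at most `ε`. The mean of `c` and that of `b
  -- - c` each contribute `2π ε ‖ξ‖ ^ 2`.
  obtain ⟨ε, hε, hεδ⟩ : ∃ ε > 0, 4 * Real.pi * (ε * ‖ξ‖ ^ 2) ≤ δ := by
    refine ⟨δ / (4 * Real.pi * (‖ξ‖ ^ 2 + 1)), by positivity, ?_⟩
    rw [show 4 * Real.pi * (δ / (4 * Real.pi * (‖ξ‖ ^ 2 + 1)) * ‖ξ‖ ^ 2) =
      δ * (‖ξ‖ ^ 2 / (‖ξ‖ ^ 2 + 1)) by field_simp]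
    refine mul_le_of_le_one_right hδ.le ((div_le_one (by positivity)).2 (by linarith))
  obtain ⟨c, hc, hbc⟩ := Metric.mem_closure_iff.1 (mem_closure_monomialSpan (α := c0Rot n X) hb) ε hε
  rw [dist_eq_norm] at hbc
  have hc' := mem_crossedProduct_of_mem_monomialSpan hc
  have h1 := norm_integral_gaugeHom_le hc hε.le (fun p => by
    have h2 : evAmbient n p (b - c) = evAmbient n p b - evAmbient n p c := map_sub _ _ _
    rw [h, zero_sub] at h2
    rw [← norm_neg, ← h2]
    exact (norm_evAmbient_le p _).trans hbc.le) ρ ξ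
  have h3 := intervalIntegral.norm_integral_le_of_norm_le_const (a := 0) (b := 2 * Real.pi)
    (f := fun θ : ℝ => ⟪ξ, ρ.gaugeHom (Circle.exp θ) b ξ⟫_ℂ -
      ⟪ξ, ρ.gaugeHom (Circle.exp θ) c ξ⟫_ℂ) (C := ε * ‖ξ‖ ^ 2) (fun θ _ => by
      have h2 : ρ.gaugeHom (Circle.exp θ) (b - c) =
        ρ.gaugeHom (Circle.exp θ) b - ρ.gaugeHom (Circle.exp θ) c := map_sub _ _ _
      rw [← inner_sub_right, ← sub_apply, ← h2]
      calc _ ≤ ‖ξ‖ * ‖ρ.gaugeHom (Circle.exp θ) (b - c) ξ‖ := norm_inner_le_norm _ _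
        _ ≤ ‖ξ‖ * (ε * ‖ξ‖) := by
          gcongr
          exact (ContinuousLinearMap.le_opNorm _ _).trans (mul_le_mul_of_nonneg_right
            ((ρ.norm_gaugeHom_le _ _).trans hbc.le) (norm_nonneg _))
        _ = _ := by ring)
  rw [intervalIntegral.integral_sub
        ((continuous_inner_gaugeHom ρ ξ hb).intervalIntegrable _ _)
        ((continuous_inner_gaugeHom ρ ξ hc').intervalIntegrable _ _), sub_zero,
        abs_of_pos Real.two_pi_pos] at h3
  have h4 := norm_le_norm_add_norm_sub'
    (∫ θ in (0 : ℝ)..2 * Real.pi, ⟪ξ, ρ.gaugeHom (Circle.exp θ) b ξ⟫_ℂ)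
    (∫ θ in (0 : ℝ)..2 * Real.pi, ⟪ξ, ρ.gaugeHom (Circle.exp θ) c ξ⟫_ℂ)
  linarith

-- For `star a * a` the averaged integrand is the square of the norm of the gauged `a` applied to
-- `ξ`. It is continuous and nonnegative with zero integral, so it vanishes at the trivial gauge.
set_option synthInstance.maxHeartbeats 400000 in
theorem evHom_injective :
    Function.Injective (evHom : crossedProduct (c0Rot n X) → C₀(X × Circle, _)) := by
  refine (injective_iff_map_eq_zero evHom).2 fun a ha => Subtype.ext ?_
  have hev : ∀ p, evAmbient n p (a : CovariantRep.Ambient (c0Rot n X)) = 0 := fun p => by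
    rw [← evHom_apply, ha]; rfl
  refine CovariantRep.Ambient.ext_coordHom fun ρ => ?_
  have h0 : ρ.coordHom ((0 : crossedProduct (c0Rot n X)) : CovariantRep.Ambient (c0Rot n X)) = 0 :=
    ρ.coordHom.map_zero'
  rw [h0]
  ext ξ
  by_contra hne
  have hstar : ∀ t, ρ.gaugeHom t (star (a : CovariantRep.Ambient (c0Rot n X)) * a) =
      star (ρ.gaugeHom t a) * ρ.gaugeHom t a := fun t =>
    ((ρ.gaugeHom t).map_mul' _ _).trans (congrArg (· * _) ((ρ.gaugeHom t).map_star' _))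
  have h1 := integral_gaugeHom_eq_zero (star a * a).2 (fun p =>
    ((evAmbient n p).map_mul' _ _).trans (by rw [show (evAmbient n p).toFun a = 0 from hev p, mul_zero])) ρ ξ
  have h2 : ∀ θ : ℝ, ⟪ξ, ρ.gaugeHom (Circle.exp θ) ((star a * a : crossedProduct (c0Rot n X)) :
      CovariantRep.Ambient (c0Rot n X)) ξ⟫_ℂ =
      ((‖ρ.gaugeHom (Circle.exp θ) (a : CovariantRep.Ambient (c0Rot n X)) ξ‖ ^ 2 : ℝ) : ℂ) := by
    intro θ
    have h3 := hstar (Circle.exp θ)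
    change ⟪ξ, ρ.gaugeHom (Circle.exp θ) (star (a : CovariantRep.Ambient (c0Rot n X)) * a) ξ⟫_ℂ = _
    rw [h3, mul_apply_eq_comp, ContinuousLinearMap.star_eq_adjoint,
      ContinuousLinearMap.adjoint_inner_right, inner_self_eq_norm_sq_to_K]
    push_cast; rfl
  simp only [h2] at h1
  rw [intervalIntegral.integral_ofReal, Complex.ofReal_eq_zero] at h1
  refine (intervalIntegral.integral_pos (a := 0) (b := 2 * Real.pi) Real.two_pi_pos
    (f := fun θ => ‖ρ.gaugeHom (Circle.exp θ) (a : CovariantRep.Ambient (c0Rot n X)) ξ‖ ^ 2)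
    ?_ (fun _ _ => by positivity) ⟨0, ⟨le_rfl, Real.two_pi_pos.le⟩, ?_⟩).ne' h1
  · exact ((((ρ.continuous_gaugeHom a.2).comp Circle.exp.continuous).clm_apply
      continuous_const).norm.pow 2).continuousOn
  · have h5 : ρ.coordHom (a : CovariantRep.Ambient (c0Rot n X)) ξ ≠ 0 := hne
    rw [← ρ.gaugeHom_one a.2] at h5
    simp only [Circle.exp_zero]
    positivity

end Faithful

/-! ### Uniform approximation of functions on `X × 𝕋` -/

section Approximation

theorem ZeroAtInftyContinuousMap.exists_eq_one_of_notMem {Y : Type*} [TopologicalSpace Y]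
    [LocallyCompactSpace Y] [T2Space Y] {t : Set Y} (ht : IsClosed t) {y : Y} (hy : y ∉ t) :
    ∃ f : C₀(Y, ℂ), f y = 1 ∧ ∀ x ∈ t, f x = 0 := by
  obtain ⟨f, h1, h0, hf, -⟩ := exists_continuous_one_zero_of_isCompact (isCompact_singleton (x := y))
    ht (Set.disjoint_singleton_left.2 hy)
  refine ⟨⟨⟨fun x => (f x : ℂ), by fun_prop⟩, ?_⟩, ?_, fun x hx => ?_⟩
  · exact (hf.comp_left (g := ((↑) : ℝ → ℂ)) Complex.ofReal_zero).is_zero_at_infty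
  · change ((f y : ℝ) : ℂ) = 1
    rw [h1 rfl]; simp
  · change ((f x : ℝ) : ℂ) = 0
    rw [h0 hx]; simp

/-- The extension by zero of a function vanishing at infinity to the one-point compactification. -/
def ZeroAtInftyContinuousMap.toOnePoint {Y : Type*} [TopologicalSpace Y] [T2Space Y]
    (f : C₀(Y, ℂ)) : C(OnePoint Y, ℂ) :=
  OnePoint.continuousMapMk f.toContinuousMap 0
    (by rw [Filter.coclosedCompact_eq_cocompact]; exact f.zero_at_infty')

@[simp]
theorem ZeroAtInftyContinuousMap.toOnePoint_coe {Y : Type*} [TopologicalSpace Y] [T2Space Y]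
    (f : C₀(Y, ℂ)) (y : Y) : f.toOnePoint y = f y := rfl

@[simp]
theorem ZeroAtInftyContinuousMap.toOnePoint_infty {Y : Type*} [TopologicalSpace Y] [T2Space Y]
    (f : C₀(Y, ℂ)) : f.toOnePoint OnePoint.infty = 0 := rfl

variable {X : Type u} [TopologicalSpace X] [LocallyCompactSpace X] [T2Space X]

/-- The function `φ(x) z ^ m` vanishing at infinity on `X × 𝕋`. -/
def circleMonomial (φ : C₀(X, ℂ)) (m : ℤ) : C₀(X × Circle, ℂ) where
  toFun p := φ p.1 * ((p.2 ^ m : Circle) : ℂ)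
  continuous_toFun := ((map_continuous φ).comp continuous_fst).mul
    ((Circle.continuous_coe_zpow m).comp continuous_snd)
  zero_at_infty' := by
    rw [tendsto_zero_iff_norm_tendsto_zero]
    simp only [norm_mul, Circle.norm_coe, mul_one]
    rw [← tendsto_zero_iff_norm_tendsto_zero]
    exact (zero_at_infty φ).comp (tendsto_fst_cocompact_of_compactSpace X Circle)

theorem circleMonomial_apply (φ : C₀(X, ℂ)) (m : ℤ) (p : X × Circle) :
    circleMonomial φ m p = φ p.1 * ((p.2 ^ m : Circle) : ℂ) := rfl

variable (X) in
/-- The constant function `1` and the functions `φ(x) z ^ m`. -/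
def circleMonomials : Set C(OnePoint (X × Circle), ℂ) :=
  insert 1 {g | ∃ (φ : C₀(X, ℂ)) (m : ℤ), g = (circleMonomial φ m).toOnePoint}

theorem mul_mem_circleMonomials {f g : C(OnePoint (X × Circle), ℂ)} (hf : f ∈ circleMonomials X)
    (hg : g ∈ circleMonomials X) : f * g ∈ circleMonomials X := by
  obtain rfl | ⟨φ, m, rfl⟩ := hf
  · rwa [one_mul]
  obtain rfl | ⟨ψ, l, rfl⟩ := hg
  · rw [mul_one]; exact Or.inr ⟨φ, m, rfl⟩
  refine Or.inr ⟨φ * ψ, m + l, ContinuousMap.ext fun p => ?_⟩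
  induction p using OnePoint.rec with
  | infty => simp
  | coe p =>
    simp only [ContinuousMap.mul_apply, ZeroAtInftyContinuousMap.toOnePoint_coe,
      circleMonomial_apply, ZeroAtInftyContinuousMap.mul_apply, zpow_add, Circle.coe_mul]
    ring

theorem star_mem_circleMonomials {f : C(OnePoint (X × Circle), ℂ)} (hf : f ∈ circleMonomials X) :
    star f ∈ circleMonomials X := by
  obtain rfl | ⟨φ, m, rfl⟩ := hf
  · rw [star_one]; exact Or.inl rfl
  refine Or.inr ⟨star φ, -m, ContinuousMap.ext fun p => ?_⟩
  induction p using OnePoint.rec with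
  | infty => simp
  | coe p =>
    simp only [ContinuousMap.star_apply, ZeroAtInftyContinuousMap.toOnePoint_coe,
      circleMonomial_apply, ZeroAtInftyContinuousMap.star_apply, zpow_neg, star_mul',
      Circle.coe_inv_eq_conj]
    rfl

theorem exists_circleMonomial_ne {p q : OnePoint (X × Circle)} (hpq : p ≠ q) :
    ∃ (φ : C₀(X, ℂ)) (m : ℤ), (circleMonomial φ m).toOnePoint p ≠
      (circleMonomial φ m).toOnePoint q := by
  have hinf : ∀ p : X × Circle, ∃ (φ : C₀(X, ℂ)) (m : ℤ), circleMonomial φ m p ≠ 0 := by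
    intro p
    obtain ⟨φ, h, -⟩ := ZeroAtInftyContinuousMap.exists_eq_one_of_notMem isClosed_empty
      (Set.notMem_empty p.1)
    exact ⟨φ, 0, by simp [circleMonomial_apply, h]⟩
  induction p using OnePoint.rec with
  | infty =>
    induction q using OnePoint.rec with
    | infty => exact absurd rfl hpq
    | coe q => obtain ⟨φ, m, h⟩ := hinf q; exact ⟨φ, m, h.symm⟩
  | coe p =>
    induction q using OnePoint.rec with
    | infty => exact hinf p
    | coe q =>
      simp only [ZeroAtInftyContinuousMap.toOnePoint_coe, circleMonomial_apply]
      by_cases h1 : p.1 = q.1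
      · have h2 : p.2 ≠ q.2 := fun h2 => hpq (congrArg _ (Prod.ext h1 h2))
        obtain ⟨φ, h, -⟩ := ZeroAtInftyContinuousMap.exists_eq_one_of_notMem isClosed_empty
          (Set.notMem_empty p.1)
        refine ⟨φ, 1, ?_⟩
        rw [← h1, h, zpow_one, zpow_one, one_mul, one_mul]
        exact fun h => h2 (Circle.ext h)
      · obtain ⟨φ, h, h'⟩ := ZeroAtInftyContinuousMap.exists_eq_one_of_notMem
          (isClosed_singleton (x := q.1)) (show p.1 ∉ {q.1} from h1)
        exact ⟨φ, 0, by simp [h, h' _ rfl]⟩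

/-- A space of functions on `X × 𝕋` that contains the functions `φ(x) z ^ m` approximates all
functions vanishing at infinity. -/
theorem exists_norm_sub_le_of_circleMonomial_mem (V : Submodule ℂ (X × Circle → ℂ))
    (hV : ∀ (φ : C₀(X, ℂ)) (m : ℤ), ⇑(circleMonomial φ m) ∈ V) (c : C₀(X × Circle, ℂ))
    {ε : ℝ} (hε : 0 < ε) : ∃ g ∈ V, ∀ p, ‖c p - g p‖ ≤ ε := by
  -- The constant `1` among the generators makes the algebra unital, as Stone–Weierstrass on the
  -- compactification requires.
  let S : StarSubalgebra ℂ C(OnePoint (X × Circle), ℂ) :=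
    (NonUnitalStarAlgebra.adjoin ℂ (circleMonomials X)).toStarSubalgebra
      (NonUnitalStarAlgebra.subset_adjoin ℂ _ (Or.inl rfl))
  have hS : S.topologicalClosure = ⊤ := by
    refine ContinuousMap.starSubalgebra_topologicalClosure_eq_top_of_separatesPoints S ?_
    intro p q hpq
    obtain ⟨φ, m, h⟩ := exists_circleMonomial_ne hpq
    exact ⟨_, ⟨_, NonUnitalStarAlgebra.subset_adjoin ℂ _ (Or.inr ⟨φ, m, rfl⟩), rfl⟩, h⟩
  have hspan : (S : Set C(OnePoint (X × Circle), ℂ)) ⊆ Submodule.span ℂ (circleMonomials X) :=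
    NonUnitalStarAlgebra.adjoin_subset_span_of_mul_mem_of_star_mem
      (fun _ hf _ hg => mul_mem_circleMonomials hf hg) fun _ hf => star_mem_circleMonomials hf
  have hmem : c.toOnePoint ∈ closure (S : Set C(OnePoint (X × Circle), ℂ)) := by
    have : c.toOnePoint ∈ S.topologicalClosure := hS ▸ StarSubalgebra.mem_top
    exact this
  obtain ⟨g, hg, hcg⟩ := Metric.mem_closure_iff.1 hmem (ε / 2) (half_pos hε)
  -- Subtracting the value at infinity removes the constant component. As `c` vanishes there, this
  -- costs only another `ε / 2`.
  have hgV : (fun p : X × Circle => g p - g OnePoint.infty) ∈ V := by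
    have hg' := hspan hg
    clear hcg hg
    induction hg' using Submodule.span_induction with
    | mem g hg =>
      obtain rfl | ⟨φ, m, rfl⟩ := hg
      · convert V.zero_mem using 1
        ext p; simp
      · convert hV φ m using 1
        ext p; simp
    | zero =>
      convert V.zero_mem using 1
      ext p; simp
    | add f g _ _ hf hg =>
      convert V.add_mem hf hg using 1
      ext p
      simp only [ContinuousMap.add_apply, Pi.add_apply]
      ring
    | smul r f _ hf =>
      convert V.smul_mem r hf using 1
      ext p
      simp only [ContinuousMap.smul_apply, Pi.smul_apply, smul_eq_mul]
      ring
  refine ⟨_, hgV, fun p => ?_⟩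
  rw [dist_eq_norm] at hcg
  have h1 := (ContinuousMap.norm_coe_le_norm (c.toOnePoint - g) p).trans hcg.le
  have h2 := (ContinuousMap.norm_coe_le_norm (c.toOnePoint - g) OnePoint.infty).trans hcg.le
  rw [ContinuousMap.sub_apply] at h1 h2
  simp only [ZeroAtInftyContinuousMap.toOnePoint_coe, ZeroAtInftyContinuousMap.toOnePoint_infty,
    zero_sub, norm_neg] at h1 h2
  calc ‖c p - (g p - g OnePoint.infty)‖ = ‖(c p - g p) + g OnePoint.infty‖ := by congr 1; ring
    _ ≤ _ := norm_add_le _ _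
    _ ≤ ε := by linarith

end Approximation

/-! ### The range of the transform -/

section Range

open scoped Matrix.Norms.L2Operator

variable {n : ℕ} [NeZero n] {X : Type u} [TopologicalSpace X] [AddAction (ZMod n) X]
  [ContinuousConstVAdd (ZMod n) X]

variable {A : Type v} [NonUnitalCStarAlgebra A]
  (Φ : A →⋆ₙₐ[ℂ] C₀(X × Circle, Matrix (Fin n) (Fin n) ℂ))

/-- The scalar functions `g` on `X × 𝕋` for which the function `diag(g) W_k` is in the range
of `Φ`. -/
def diagCoeffSubmodule (k : ℤ) : Submodule ℂ (X × Circle → ℂ) where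
  carrier := {g | ∃ a : A, ∀ p, Φ a p =
    Matrix.diagonal (fun i : Fin n => g (((i : ℕ) : ZMod n) +ᵥ p.1, p.2)) * cyclicShift n p.2 k}
  add_mem' := by
    rintro f g ⟨a, ha⟩ ⟨b, hb⟩
    refine ⟨a + b, fun p => ?_⟩
    rw [map_add, ZeroAtInftyContinuousMap.add_apply, ha, hb, ← add_mul, Matrix.diagonal_add]
    rfl
  zero_mem' := by
    refine ⟨0, fun p => ?_⟩
    rw [map_zero]
    simp
  smul_mem' := by
    rintro r g ⟨a, ha⟩
    refine ⟨r • a, fun p => ?_⟩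
    rw [map_smul, ZeroAtInftyContinuousMap.smul_apply, ha, ← smul_mul_assoc, ← Matrix.diagonal_smul]
    rfl

/-- An equivariant function is determined by diagonal coefficients, which are the values of one
scalar function along orbits. -/
theorem eq_sum_diagonal_of_equivariant {F : X × Circle → Matrix (Fin n) (Fin n) ℂ}
    (hF : ∀ (x : X) (z : Circle) (k : ℤ), F ((k : ZMod n) +ᵥ x, z) =
      cyclicShift n z (-k) * F (x, z) * cyclicShift n z k) (x : X) (z : Circle) :
    F (x, z) = ∑ k : Fin n, Matrix.diagonal (fun i : Fin n =>
      (F (((i : ℕ) : ZMod n) +ᵥ x, z) * cyclicShift n z (-((k : ℕ) : ℤ))) 0 0) *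
        cyclicShift n z ((k : ℕ) : ℤ) := by
  refine (eq_sum_diagonal_mul_cyclicShift z (F (x, z))).trans ?_
  refine Finset.sum_congr rfl fun k _ => ?_
  congr 2
  ext i
  -- Translating the point by `i` conjugates by the `i`-th power of the shift, which moves the
  -- diagonal entry `(i, i)` to the corner.
  have h1 := hF x z ((i : ℕ) : ℤ)
  rw [Int.cast_natCast] at h1
  rw [h1]
  simp only [mul_assoc]
  rw [← cyclicShift_add, add_comm, cyclicShift_add, ← mul_assoc (F (x, z)), Matrix.mul_apply]
  have h2 : ∀ j, cyclicShift n z (-((i : ℕ) : ℤ)) 0 j = if j = i then 1 else 0 := by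
    intro j
    have h3 := congrArg star (cyclicShift_apply_zero_natCast z i j)
    rw [← Matrix.star_apply, star_cyclicShift] at h3
    rw [h3]
    split_ifs <;> simp
  simp only [h2, Matrix.mul_apply, cyclicShift_apply_zero_natCast]
  simp

/-- The coefficient functions of a matrix-valued function. -/
def shiftCoeff (F : C₀(X × Circle, Matrix (Fin n) (Fin n) ℂ)) (k : ℤ) : C₀(X × Circle, ℂ) where
  toFun p := (F p * cyclicShift n p.2 (-k)) 0 0
  continuous_toFun := ((map_continuous F).matrix_mul
    ((continuous_cyclicShift _).comp continuous_snd)).matrix_elem 0 0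
  zero_at_infty' := by
    refine squeeze_zero_norm (fun p => (Matrix.norm_entry_le_l2_opNorm _ 0 0).trans
      (norm_mul_cyclicShift _ _ _).le) ?_
    exact tendsto_zero_iff_norm_tendsto_zero.1 (zero_at_infty F)

theorem ZeroAtInftyContinuousMap.norm_le_of_forall {Y E : Type*} [TopologicalSpace Y]
    [SeminormedAddCommGroup E] {f : C₀(Y, E)} {C : ℝ} (hC : 0 ≤ C) (h : ∀ y, ‖f y‖ ≤ C) :
    ‖f‖ ≤ C := by
  rw [← ZeroAtInftyContinuousMap.norm_toBCF_eq_norm]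
  exact (BoundedContinuousFunction.norm_le hC).2 h

/-- A homomorphism with closed range whose range contains the functions `diag(φ(x)) W_k` has all
equivariant functions in its range. -/
theorem exists_eq_of_equivariant [LocallyCompactSpace X] [T2Space X]
    (hΦ : IsClosed (Set.range Φ)) (hmon : ∀ (φ : C₀(X, ℂ)) (k : ℤ), ∃ a, ∀ p,
      Φ a p = diagHom p.1 φ * cyclicShift n p.2 k)
    (F : C₀(X × Circle, Matrix (Fin n) (Fin n) ℂ))
    (hF : ∀ (x : X) (z : Circle) (k : ℤ), F ((k : ZMod n) +ᵥ x, z) =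
      cyclicShift n z (-k) * F (x, z) * cyclicShift n z k) :
    ∃ a, Φ a = F := by
  have hV : ∀ (k : ℤ) (φ : C₀(X, ℂ)) (m : ℤ), ⇑(circleMonomial φ m) ∈ diagCoeffSubmodule Φ k := by
    intro k φ m
    -- The factor `z ^ m` is the `(m n)`-th power of the shift.
    obtain ⟨a, ha⟩ := hmon φ (k + m * n)
    refine ⟨a, fun p => ?_⟩
    rw [ha, cyclicShift_mul_natCast, mul_smul_comm, ← smul_mul_assoc, diagHom_apply,
      ← Matrix.diagonal_smul]
    congr 2
    ext i
    simp only [Pi.smul_apply, circleMonomial_apply, smul_eq_mul]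
    ring
  have hn : (n : ℝ) ≠ 0 := by exact_mod_cast NeZero.ne n
  change F ∈ Set.range Φ
  rw [← hΦ.closure_eq]
  refine Metric.mem_closure_iff.2 fun ε hε => ?_
  -- There are `n` coefficients, so the total error is at most `ε / 2`.
  have hδ : 0 < ε / (2 * n) := by positivity
  have happ : ∀ k : Fin n, ∃ a, ∀ p : X × Circle,
      ‖Matrix.diagonal (fun i : Fin n =>
          shiftCoeff F ((k : ℕ) : ℤ) (((i : ℕ) : ZMod n) +ᵥ p.1, p.2)) *
        cyclicShift n p.2 ((k : ℕ) : ℤ) - Φ a p‖ ≤ ε / (2 * n) := by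
    intro k
    obtain ⟨g, ⟨a, ha⟩, hg⟩ := exists_norm_sub_le_of_circleMonomial_mem
      (diagCoeffSubmodule Φ ((k : ℕ) : ℤ)) (hV _) (shiftCoeff F ((k : ℕ) : ℤ)) hδ
    refine ⟨a, fun p => ?_⟩
    rw [ha, ← sub_mul, norm_mul_cyclicShift, Matrix.diagonal_sub, Matrix.l2_opNorm_diagonal,
      pi_norm_le_iff_of_nonneg hδ.le]
    exact fun i => hg _
  choose a ha using happ
  refine ⟨_, ⟨∑ k, a k, rfl⟩, ?_⟩
  rw [dist_eq_norm]
  refine (ZeroAtInftyContinuousMap.norm_le_of_forall (half_pos hε).le fun p => ?_).trans_lt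
    (half_lt_self hε)
  have hsum : Φ (∑ k, a k) p = ∑ k, Φ (a k) p := by
    rw [map_sum]
    exact map_sum (⟨⟨fun G : C₀(X × Circle, Matrix (Fin n) (Fin n) ℂ) => G p, rfl⟩,
      fun _ _ => rfl⟩ : C₀(X × Circle, Matrix (Fin n) (Fin n) ℂ) →+ _) _ _
  rw [ZeroAtInftyContinuousMap.sub_apply, hsum]
  refine (congrArg (fun M => ‖M - ∑ k, Φ (a k) p‖)
    (eq_sum_diagonal_of_equivariant hF p.1 p.2)).trans_le ?_
  rw [← Finset.sum_sub_distrib]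
  refine (norm_sum_le_of_le _ fun k _ => ha k p).trans ?_
  simp only [Finset.sum_const, Finset.card_univ, Fintype.card_fin, nsmul_eq_mul]
  apply le_of_eq
  field_simp

/-- An injective *-homomorphism of C*-algebras is isometric, and its domain is complete. -/
theorem isClosed_range_evHom :
    IsClosed (Set.range (evHom : crossedProduct (c0Rot n X) → C₀(X × Circle, _))) :=
  (AddMonoidHomClass.isometry_of_norm (evHom : crossedProduct (c0Rot n X) →⋆ₙₐ[ℂ] _)
    (NonUnitalStarAlgHom.norm_map _ evHom_injective)).isClosedEmbedding.isClosed_range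

/-- The transforms of the elements of the crossed product are the equivariant functions. -/
theorem exists_evHom_eq [LocallyCompactSpace X] [T2Space X]
    (F : C₀(X × Circle, Matrix (Fin n) (Fin n) ℂ))
    (hF : ∀ (x : X) (z : Circle) (k : ℤ), F ((k : ZMod n) +ᵥ x, z) =
      cyclicShift n z (-k) * F (x, z) * cyclicShift n z k) :
    ∃ a : crossedProduct (c0Rot n X), evHom a = F :=
  exists_eq_of_equivariant evHom isClosed_range_evHom
    (fun φ k => ⟨⟨_, monomial_mem_crossedProduct φ k⟩, fun p => by
      rw [evHom_apply, evAmbient_monomial]⟩) F hF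

end Range

/-! ### Algebras of equivariant matrix-valued functions -/

section EquivariantTransform

open scoped Matrix.Norms.L2Operator

variable (n : ℕ) [NeZero n] {X : Type u} [TopologicalSpace X] [AddAction (ZMod n) X]

/-- The quotient map onto the product of the orbit space and the circle. -/
def orbitMap (p : X × Circle) : AddAction.orbitRel.Quotient (ZMod n) X × Circle :=
  (Quotient.mk _ p.1, p.2)

variable {n}

theorem orbitMap_eq_iff {p q : X × Circle} :
    orbitMap n p = orbitMap n q ↔ ∃ k : ℤ, q = ((k : ZMod n) +ᵥ p.1, p.2) := by
  rw [orbitMap, orbitMap, Prod.mk.injEq, eq_comm (a := (Quotient.mk _ p.1)), Quotient.eq,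
    AddAction.orbitRel_apply, AddAction.mem_orbit_iff]
  constructor
  · rintro ⟨⟨k, hk⟩, h⟩
    exact ⟨k.val, Prod.ext (by simpa using hk.symm) h.symm⟩
  · rintro ⟨k, rfl⟩
    exact ⟨⟨k, rfl⟩, rfl⟩

variable [ContinuousConstVAdd (ZMod n) X]

theorem isOpenQuotientMap_orbitMap : IsOpenQuotientMap (orbitMap n (X := X)) :=
  (AddAction.isOpenQuotientMap_quotientMk (Γ := ZMod n) (T := X)).prodMap .id

instance [LocallyCompactSpace X] :
    LocallyCompactSpace (AddAction.orbitRel.Quotient (ZMod n) X) :=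
  (AddAction.isOpenQuotientMap_quotientMk (Γ := ZMod n) (T := X)).locallyCompactSpace

variable {A : Type v} [NonUnitalCStarAlgebra A]

/-- `Φ` is an isomorphism onto the algebra of equivariant functions in `C₀(X × 𝕋, M_n(ℂ))`. -/
structure IsEquivariantTransform
    (Φ : A →⋆ₙₐ[ℂ] C₀(X × Circle, Matrix (Fin n) (Fin n) ℂ)) : Prop where
  injective : Function.Injective Φ
  vadd : ∀ (a : A) (x : X) (z : Circle) (k : ℤ), Φ a ((k : ZMod n) +ᵥ x, z) =
    cyclicShift n z (-k) * Φ a (x, z) * cyclicShift n z k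
  exists_eq : ∀ F : C₀(X × Circle, Matrix (Fin n) (Fin n) ℂ),
    (∀ (x : X) (z : Circle) (k : ℤ), F ((k : ZMod n) +ᵥ x, z) =
      cyclicShift n z (-k) * F (x, z) * cyclicShift n z k) → ∃ a, Φ a = F
  exists_monomial : ∀ (φ : C₀(X, ℂ)) (k : ℤ), ∃ a, ∀ p,
    Φ a p = diagHom p.1 φ * cyclicShift n p.2 k

theorem isEquivariantTransform_evHom [LocallyCompactSpace X] [T2Space X] :
    IsEquivariantTransform
      (evHom : crossedProduct (c0Rot n X) →⋆ₙₐ[ℂ] C₀(X × Circle, Matrix (Fin n) (Fin n) ℂ)) where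
  injective := evHom_injective
  vadd := evHom_vadd
  exists_eq := exists_evHom_eq
  exists_monomial φ k := ⟨⟨_, monomial_mem_crossedProduct φ k⟩, fun p => by
    rw [evHom_apply, evAmbient_monomial]⟩

variable {Φ : A →⋆ₙₐ[ℂ] C₀(X × Circle, Matrix (Fin n) (Fin n) ℂ)} (hΦ : IsEquivariantTransform Φ)

include hΦ

namespace IsEquivariantTransform

theorem ext {a b : A} (h : ∀ p, Φ a p = Φ b p) : a = b :=
  hΦ.injective (DFunLike.ext _ _ h)

theorem norm_map (a : A) : ‖Φ a‖ = ‖a‖ := NonUnitalStarAlgHom.norm_map Φ hΦ.injective a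

theorem norm_le {a : A} {C : ℝ} (hC : 0 ≤ C) (h : ∀ p, ‖Φ a p‖ ≤ C) : ‖a‖ ≤ C := by
  rw [← hΦ.norm_map]
  exact ZeroAtInftyContinuousMap.norm_le_of_forall hC h

theorem norm_apply_le (a : A) (p : X × Circle) : ‖Φ a p‖ ≤ ‖a‖ := by
  rw [← hΦ.norm_map, ← ZeroAtInftyContinuousMap.norm_toBCF_eq_norm]
  exact (Φ a).toBCF.norm_coe_le_norm p

theorem vadd_eq_zero_iff (a : A) {p q : X × Circle} (h : orbitMap n p = orbitMap n q) :
    Φ a q = 0 ↔ Φ a p = 0 := by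
  have key : ∀ {p q : X × Circle}, orbitMap n p = orbitMap n q → Φ a p = 0 → Φ a q = 0 := by
    intro p q h h0
    obtain ⟨k, rfl⟩ := orbitMap_eq_iff.1 h
    rw [hΦ.vadd, h0, mul_zero, zero_mul]
  exact ⟨key h.symm, key h⟩

theorem norm_vadd (a : A) {p q : X × Circle} (h : orbitMap n p = orbitMap n q) :
    ‖Φ a q‖ = ‖Φ a p‖ := by
  obtain ⟨k, rfl⟩ := orbitMap_eq_iff.1 h
  rw [hΦ.vadd, norm_mul_cyclicShift, norm_cyclicShift_mul]

variable [LocallyCompactSpace X] [T2Space X]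

/-- Continuous functions on the compactified base act on the algebra. -/
theorem exists_smul (f : C(OnePoint (AddAction.orbitRel.Quotient (ZMod n) X × Circle), ℂ))
    (a : A) : ∃ b, ∀ p, Φ b p = f (orbitMap n p) • Φ a p := by
  have hcont : Continuous fun p : X × Circle => f (orbitMap n p) :=
    f.continuous.comp (OnePoint.continuous_coe.comp isOpenQuotientMap_orbitMap.continuous)
  obtain ⟨b, hb⟩ := hΦ.exists_eq
    { toFun := fun p => f (orbitMap n p) • Φ a p
      continuous_toFun := hcont.smul (map_continuous (Φ a))
      zero_at_infty' := by
        refine squeeze_zero_norm (a := fun p => ‖f‖ * ‖Φ a p‖) (fun p => ?_) ?_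
        · rw [norm_smul]
          exact mul_le_mul_of_nonneg_right (f.norm_coe_le_norm _) (norm_nonneg _)
        · simpa using! (tendsto_zero_iff_norm_tendsto_zero.1 (zero_at_infty (Φ a))).const_mul ‖f‖ }
    (fun x z k => by
      have h : orbitMap n (x, z) = orbitMap n ((k : ZMod n) +ᵥ x, z) :=
        orbitMap_eq_iff.2 ⟨k, rfl⟩
      change f ↑(orbitMap n ((k : ZMod n) +ᵥ x, z)) • Φ a ((k : ZMod n) +ᵥ x, z) =
        _ * (f ↑(orbitMap n (x, z)) • Φ a (x, z)) * _
      rw [hΦ.vadd, mul_smul_comm, smul_mul_assoc, ← h])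
  exact ⟨b, fun p => by rw [hb]; rfl⟩

/-- The norm of a transform as a function on the base. -/
theorem exists_norm (a : A) : ∃ N : C(OnePoint (AddAction.orbitRel.Quotient (ZMod n) X × Circle), ℝ),
    N OnePoint.infty = 0 ∧ ∀ p, N (orbitMap n p) = ‖Φ a p‖ := by
  -- The section `s` need not be continuous: the norm is constant on orbits, so it descends to a
  -- continuous function.
  let s := Function.surjInv (isOpenQuotientMap_orbitMap (n := n) (X := X)).surjective
  have hs : ∀ p, ‖Φ a (s (orbitMap n p))‖ = ‖Φ a p‖ := fun p =>
    hΦ.norm_vadd a (Function.surjInv_eq _ (orbitMap n p)).symm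
  have hcont : Continuous fun w => ‖Φ a (s w)‖ := by
    rw [← isOpenQuotientMap_orbitMap.continuous_comp_iff]
    refine (map_continuous (Φ a)).norm.congr fun p => (hs p).symm
  refine ⟨OnePoint.continuousMapMk ⟨_, hcont⟩ 0 ?_, rfl, hs⟩
  rw [Filter.coclosedCompact_eq_cocompact]
  refine Metric.tendsto_nhds.2 fun ε hε => ?_
  have h0 := Metric.tendsto_nhds.1 (zero_at_infty (Φ a)) ε hε
  obtain ⟨K, hK, hKε⟩ := Filter.mem_cocompact.1 h0
  filter_upwards [(hK.image isOpenQuotientMap_orbitMap.continuous).compl_mem_cocompact] with w hw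
  have h1 : s w ∈ Kᶜ := fun h => hw ⟨s w, h, Function.surjInv_eq _ w⟩
  have h2 := hKε h1
  simpa using h2

/-- The transforms take all values at a point. -/
theorem exists_apply_eq (hfree : ∀ (g : ZMod n) (x : X), g +ᵥ x = x → g = 0) (p : X × Circle)
    (M : Matrix (Fin n) (Fin n) ℂ) : ∃ a, Φ a p = M := by
  -- Freeness makes the `n` points of the orbit distinct, so bump functions realize every diagonal
  -- matrix; multiplying by powers of the shift then gives every matrix.
  have hinj : ∀ i j : Fin n, ((i : ℕ) : ZMod n) +ᵥ p.1 = ((j : ℕ) : ZMod n) +ᵥ p.1 → i = j := by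
    intro i j h
    refine Fin.eq_of_intCast_dvd_sub ((ZMod.intCast_zmod_eq_zero_iff_dvd _ n).1 ?_)
    push_cast
    refine hfree _ p.1 ?_
    rw [sub_eq_neg_add, ← vadd_vadd, ← h, vadd_vadd, neg_add_cancel, zero_vadd]
  have hχ : ∀ i : Fin n, ∃ χ : C₀(X, ℂ), ∀ j : Fin n,
      χ (((j : ℕ) : ZMod n) +ᵥ p.1) = if j = i then 1 else 0 := by
    intro i
    obtain ⟨χ, h1, h0⟩ := ZeroAtInftyContinuousMap.exists_eq_one_of_notMem
      (t := (fun j : Fin n => ((j : ℕ) : ZMod n) +ᵥ p.1) '' {i}ᶜ)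
      (Set.toFinite _).isClosed (y := ((i : ℕ) : ZMod n) +ᵥ p.1) (by
        rintro ⟨j, hj, h⟩
        exact hj (hinj j i h))
    refine ⟨χ, fun j => ?_⟩
    split_ifs with h
    · rw [h, h1]
    · exact h0 _ ⟨j, h, rfl⟩
  choose χ hχ using hχ
  have hd : ∀ (d : Fin n → ℂ) (k : ℤ), ∃ a, Φ a p = Matrix.diagonal d * cyclicShift n p.2 k := by
    intro d k
    obtain ⟨a, ha⟩ := hΦ.exists_monomial (∑ i, d i • χ i) k
    refine ⟨a, ?_⟩
    rw [ha, diagHom_apply]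
    congr 2
    ext j
    have hsum : (∑ i, d i • χ i) (((j : ℕ) : ZMod n) +ᵥ p.1) =
        ∑ i, (d i • χ i) (((j : ℕ) : ZMod n) +ᵥ p.1) :=
      map_sum (⟨⟨fun G : C₀(X, ℂ) => G (((j : ℕ) : ZMod n) +ᵥ p.1), rfl⟩, fun _ _ => rfl⟩ :
        C₀(X, ℂ) →+ ℂ) _ _
    rw [hsum]
    simp [hχ]
  choose a ha using hd
  refine ⟨∑ k : Fin n, a (fun i => (M * cyclicShift n p.2 (-((k : ℕ) : ℤ))) i i) k, ?_⟩
  rw [map_sum]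
  refine (map_sum (⟨⟨fun G : C₀(X × Circle, Matrix (Fin n) (Fin n) ℂ) => G p, rfl⟩,
      fun _ _ => rfl⟩ : C₀(X × Circle, Matrix (Fin n) (Fin n) ℂ) →+ _) _ _).trans ?_
  refine Eq.trans ?_ (eq_sum_diagonal_mul_cyclicShift p.2 M).symm
  exact Finset.sum_congr rfl fun k _ => ha _ _

/-- The transforms separate a point of the base from a closed set. -/
theorem exists_apply_ne_zero (hfree : ∀ (g : ZMod n) (x : X), g +ᵥ x = x → g = 0)
    {t : Set (AddAction.orbitRel.Quotient (ZMod n) X × Circle)} (ht : IsClosed t)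
    {p : X × Circle} (hp : orbitMap n p ∉ t) :
    ∃ a, Φ a p ≠ 0 ∧ ∀ q, orbitMap n q ∈ t → Φ a q = 0 := by
  obtain ⟨f, h1, h0⟩ := ZeroAtInftyContinuousMap.exists_eq_one_of_notMem ht hp
  obtain ⟨a, ha⟩ := hΦ.exists_apply_eq hfree p 1
  obtain ⟨b, hb⟩ := hΦ.exists_smul f.toOnePoint a
  refine ⟨b, ?_, fun q hq => ?_⟩
  · rw [hb, ZeroAtInftyContinuousMap.toOnePoint_coe, h1, ha, one_smul]
    have : Nonempty (Fin n) := ⟨0⟩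
    exact one_ne_zero
  · rw [hb, ZeroAtInftyContinuousMap.toOnePoint_coe, h0 _ hq, zero_smul]

/-- The annihilator of a representation in the functions on the compactified base. -/
def annihilator (ρ : IrreducibleRep.{v, w} A) :
    Ideal C(OnePoint (AddAction.orbitRel.Quotient (ZMod n) X × Circle), ℂ) where
  -- Here `b` stands for the product `f a`, specified through its transform, which determines it.
  carrier := {f | ∀ a b, (∀ p, Φ b p = f (orbitMap n p) • Φ a p) → ρ.π b = 0}
  zero_mem' := by
    intro a b h
    have : b = 0 := hΦ.ext fun p => by rw [h, map_zero]; simp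
    rw [this, map_zero]
  add_mem' := by
    intro f g hf hg a b h
    obtain ⟨b₁, h₁⟩ := hΦ.exists_smul f a
    obtain ⟨b₂, h₂⟩ := hΦ.exists_smul g a
    have : b = b₁ + b₂ := hΦ.ext fun p => by
      rw [h, map_add, ZeroAtInftyContinuousMap.add_apply, h₁, h₂, ← add_smul]; rfl
    rw [this, map_add, hf a b₁ h₁, hg a b₂ h₂, add_zero]
  smul_mem' := by
    intro c f hf a b h
    obtain ⟨b₁, h₁⟩ := hΦ.exists_smul c a
    refine hf b₁ b fun p => ?_
    rw [h, h₁, smul_smul, mul_comm (f _)]; rfl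

theorem isClosed_annihilator (ρ : IrreducibleRep.{v, w} A) :
    IsClosed (hΦ.annihilator ρ :
      Set C(OnePoint (AddAction.orbitRel.Quotient (ZMod n) X × Circle), ℂ)) := by
  refine isClosed_of_closure_subset fun f hf a b h => ?_
  rw [← norm_le_zero_iff]
  refine le_of_forall_pos_le_add fun δ hδ => ?_
  obtain ⟨g, hg, hfg⟩ := Metric.mem_closure_iff.1 hf (δ / (‖a‖ + 1)) (by positivity)
  obtain ⟨c, hc⟩ := hΦ.exists_smul g a
  have h1 : ρ.π b = ρ.π (b - c) := by rw [map_sub, hg a c hc, sub_zero]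
  rw [h1, zero_add]
  refine (NonUnitalStarAlgHom.norm_apply_le ρ.π _).trans (hΦ.norm_le hδ.le fun p => ?_)
  rw [map_sub, ZeroAtInftyContinuousMap.sub_apply, h, hc, ← sub_smul, norm_smul,
    ← ContinuousMap.sub_apply]
  rw [dist_eq_norm] at hfg
  calc _ ≤ δ / (‖a‖ + 1) * ‖a‖ := mul_le_mul
        (((f - g).norm_coe_le_norm _).trans hfg.le) (hΦ.norm_apply_le a p) (norm_nonneg _)
        (by positivity)
    _ ≤ δ := by
      rw [div_mul_eq_mul_div, div_le_iff₀ (by positivity)]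
      nlinarith [norm_nonneg a]

/-- The vectors killed by all `f a` form a closed invariant subspace. If it is everything, `f`
annihilates. If it is zero, then `g` annihilates, because `f g = 0` puts the range of each `g a`
inside it. -/
theorem mem_annihilator_or_mem_annihilator (ρ : IrreducibleRep.{v, w} A)
    {f g : C(OnePoint (AddAction.orbitRel.Quotient (ZMod n) X × Circle), ℂ)} (hfg : f * g = 0) :
    f ∈ hΦ.annihilator ρ ∨ g ∈ hΦ.annihilator ρ := by
  let L : Submodule ℂ ρ.H :=
    { carrier := {ξ | ∀ a b, (∀ p, Φ b p = f (orbitMap n p) • Φ a p) → ρ.π b ξ = 0}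
      zero_mem' := fun a b _ => (ρ.π b).map_zero
      add_mem' := fun {ξ η} hξ hη a b h => by rw [map_add, hξ a b h, hη a b h, add_zero]
      smul_mem' := fun r ξ hξ a b h => by rw [map_smul, hξ a b h, smul_zero] }
  have hL : IsClosed (L : Set ρ.H) := by
    have : (L : Set ρ.H) = ⋂ (a : A) (b : A) (_ : ∀ p, Φ b p = f (orbitMap n p) • Φ a p),
        {ξ | ρ.π b ξ = 0} := by
      ext ξ; simp only [Set.mem_iInter]; rfl
    rw [this]
    exact isClosed_iInter fun a => isClosed_iInter fun b => isClosed_iInter fun _ =>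
      isClosed_eq (ρ.π b).continuous continuous_const
  rcases ρ.irreducible L hL (fun c ξ hξ a b h => by
      rw [← mul_apply_eq_comp, ← map_mul]
      refine hξ (a * c) (b * c) fun p => ?_
      rw [map_mul, map_mul, ZeroAtInftyContinuousMap.mul_apply, ZeroAtInftyContinuousMap.mul_apply,
        h, smul_mul_assoc]) with h | h
  · refine Or.inr fun a b hb => ?_
    ext ξ
    have : ρ.π b ξ ∈ L := fun c d hd => by
      rw [← mul_apply_eq_comp, ← map_mul]
      have : d * b = 0 := hΦ.ext fun p => by
        rw [map_mul, ZeroAtInftyContinuousMap.mul_apply, hd, hb, smul_mul_smul_comm,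
          ← ContinuousMap.mul_apply, hfg, map_zero]
        simp
      rw [this, map_zero]; rfl
    rw [h] at this
    exact this
  · refine Or.inl fun a b hb => ?_
    ext ξ
    have : ξ ∈ L := h ▸ Submodule.mem_top
    exact this a b hb

/-- An irreducible representation factors through a point. -/
theorem exists_ker_le (ρ : IrreducibleRep.{v, w} A) :
    ∃ p, ∀ a, Φ a p = 0 → ρ.π a = 0 := by
  -- A closed ideal of continuous functions on a compact Hausdorff space consists of all functions
  -- vanishing on its zero set, here `Uᶜ`.
  have hJ := ContinuousMap.idealOfSet_ofIdeal_isClosed (hΦ.isClosed_annihilator ρ)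
  set U := ContinuousMap.setOfIdeal (hΦ.annihilator ρ) with hU
  have hmem : ∀ f, f ∈ hΦ.annihilator ρ ↔ ∀ w ∈ (Uᶜ : Set _), f w = 0 := by
    intro f
    rw [← hJ, ContinuousMap.mem_idealOfSet]
  -- Two zeros would be separated by functions with product `0`, one of which must lie in the ideal
  -- although it equals `1` at its own point.
  have hsub : ∀ w₁ ∈ (Uᶜ : Set _), ∀ w₂ ∈ (Uᶜ : Set _), w₁ = w₂ := by
    intro w₁ h₁ w₂ h₂
    by_contra hne
    obtain ⟨O₁, O₂, hO₁, hO₂, hw₁, hw₂, hd⟩ := t2_separation hne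
    obtain ⟨f, hf1, hf0⟩ := ZeroAtInftyContinuousMap.exists_eq_one_of_notMem hO₁.isClosed_compl
      (y := w₁) (fun h => h hw₁)
    obtain ⟨g, hg1, hg0⟩ := ZeroAtInftyContinuousMap.exists_eq_one_of_notMem hO₂.isClosed_compl
      (y := w₂) (fun h => h hw₂)
    have hfg : f.toContinuousMap * g.toContinuousMap = 0 := by
      ext w
      change f w * g w = 0
      by_cases hw : w ∈ O₁
      · rw [hg0 w (fun h => Set.disjoint_left.1 hd hw h), mul_zero]
      · rw [hf0 w hw, zero_mul]
    rcases hΦ.mem_annihilator_or_mem_annihilator ρ hfg with h | h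
    · have : f w₁ = 0 := (hmem _).1 h w₁ h₁
      rw [hf1] at this
      exact one_ne_zero this
    · have : g w₂ = 0 := (hmem _).1 h w₂ h₂
      rw [hg1] at this
      exact one_ne_zero this
  have hker : ∀ (a : A) (N : C(OnePoint (AddAction.orbitRel.Quotient (ZMod n) X × Circle), ℝ)),
      (∀ p, N (orbitMap n p) = ‖Φ a p‖) → (∀ w, 0 ≤ N w) → (∀ w ∈ (Uᶜ : Set _), N w = 0) →
      ρ.π a = 0 := by
    intro a N hN hN0 hNU
    rw [← norm_le_zero_iff]
    refine le_of_forall_pos_le_add fun ε hε => ?_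
    -- This function lies in the ideal and nearly fixes `a`: the remainder has norm `ε ‖Φ a p‖ / (‖Φ
    -- a p‖ + ε) ≤ ε` at each point.
    let f : C(OnePoint (AddAction.orbitRel.Quotient (ZMod n) X × Circle), ℂ) :=
      ⟨fun w => ((N w / (N w + ε) : ℝ) : ℂ), Complex.continuous_ofReal.comp
        (N.continuous.div (N.continuous.add continuous_const) fun w => by
          have := hN0 w; positivity)⟩
    have hf : ∀ w, f w = ((N w / (N w + ε) : ℝ) : ℂ) := fun _ => rfl
    have hfJ : f ∈ hΦ.annihilator ρ := (hmem f).2 fun w hw => by rw [hf, hNU w hw]; simp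
    obtain ⟨b, hb⟩ := hΦ.exists_smul f a
    have h1 : ρ.π a = ρ.π (a - b) := by rw [map_sub, hfJ a b hb, sub_zero]
    rw [h1, zero_add]
    refine (NonUnitalStarAlgHom.norm_apply_le ρ.π _).trans (hΦ.norm_le hε.le fun p => ?_)
    have h2 : Φ (a - b) p = ((ε / (‖Φ a p‖ + ε) : ℝ) : ℂ) • Φ a p := by
      rw [map_sub, ZeroAtInftyContinuousMap.sub_apply, hb, hf, hN]
      nth_rewrite 1 [← one_smul ℂ (Φ a p)]
      rw [← sub_smul, ← Complex.ofReal_one, ← Complex.ofReal_sub]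
      congr 2
      have : ‖Φ a p‖ + ε ≠ 0 := by positivity
      field_simp
      ring
    rw [h2, norm_smul, Complex.norm_real, Real.norm_of_nonneg (by positivity), div_mul_eq_mul_div]
    exact div_le_of_le_mul₀ (by positivity) hε.le (by nlinarith [norm_nonneg (Φ a p)])
  obtain ⟨a₀, ha₀⟩ := ρ.ne_zero
  have hN0 : ∀ (a : A) (N : C(OnePoint (AddAction.orbitRel.Quotient (ZMod n) X × Circle), ℝ)),
      N OnePoint.infty = 0 → (∀ p, N (orbitMap n p) = ‖Φ a p‖) → ∀ w, 0 ≤ N w := by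
    intro a N h0 h w
    induction w using OnePoint.rec with
    | infty => exact h0.ge
    | coe w =>
      obtain ⟨p, rfl⟩ := isOpenQuotientMap_orbitMap.surjective w
      rw [h]; exact norm_nonneg _
  obtain ⟨N, hNi, hN⟩ := hΦ.exists_norm a₀
  -- Since `ρ` is nonzero on `a₀`, the zero set contains a point where the norm function of `a₀`
  -- does not vanish; that function is `0` at infinity, so the point is finite.
  obtain ⟨w, hw, hNw⟩ : ∃ w ∈ (Uᶜ : Set _), N w ≠ 0 := by
    by_contra! h
    exact ha₀ (hker a₀ N hN (hN0 a₀ N hNi hN) h)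
  induction w using OnePoint.rec with
  | infty => exact absurd hNi hNw
  | coe w =>
    obtain ⟨p, rfl⟩ := isOpenQuotientMap_orbitMap.surjective w
    refine ⟨p, fun a ha => ?_⟩
    obtain ⟨N', hN'0, hN'⟩ := hΦ.exists_norm a
    refine hker a N' hN' (hN0 a N' hN'0 hN') fun w' hw' => ?_
    rw [hsub w' hw' _ hw, hN', ha, norm_zero]

end IsEquivariantTransform

end EquivariantTransform

/-! ### Irreducible representations that factor through a matrix algebra -/

section MatrixRep

open scoped InnerProductSpace

variable {n : ℕ} {A : Type v} [NonUnitalCStarAlgebra A]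

/-- An irreducible representation that factors through a homomorphism onto `M_n(ℂ)` is unitarily
equivalent to this homomorphism. -/
theorem IrreducibleRep.exists_linearIsometryEquiv_of_ker_le (ρ : IrreducibleRep.{v, w} A)
    (ev : A →⋆ₙₐ[ℂ] Matrix (Fin n) (Fin n) ℂ) (hev : Function.Surjective ev)
    (hker : ∀ a, ev a = 0 → ρ.π a = 0) :
    ∃ V : ρ.H ≃ₗᵢ[ℂ] EuclideanSpace ℂ (ULift.{w} (Fin n)),
      ∀ a ξ, V (ρ.π a ξ) = matrixCLM.{w} n (ev a) (V ξ) := by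
  have heq : ∀ {a b}, ev a = ev b → ρ.π a = ρ.π b := by
    intro a b h
    rw [← sub_eq_zero, ← map_sub]
    exact hker _ (by rw [map_sub, h, sub_self])
  -- Lifts of the matrix units. By the kernel hypothesis their images under `ρ` satisfy the matrix
  -- unit relations exactly.
  choose e he using fun i j => hev (Matrix.single i j 1)
  have hmul : ∀ i j l, ρ.π (e i j) * ρ.π (e j l) = ρ.π (e i l) := by
    intro i j l
    rw [← map_mul]
    exact heq (by rw [map_mul, he, he, he, Matrix.single_mul_single_same, one_mul])
  have hmul0 : ∀ i j k l, j ≠ k → ρ.π (e i j) * ρ.π (e k l) = 0 := by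
    intro i j k l h
    rw [← map_mul]
    exact hker _ (by rw [map_mul, he, he, Matrix.single_mul_single_of_ne _ _ _ _ h])
  have hstar : ∀ i j, star (ρ.π (e i j)) = ρ.π (e j i) := by
    intro i j
    rw [← map_star]
    exact heq (by rw [map_star, he, he, Matrix.star_eq_conjTranspose,
      Matrix.conjTranspose_single, star_one])
  have hsum : ∀ a, ρ.π a = ∑ i, ∑ j, ev a i j • ρ.π (e i j) := by
    intro a
    have h1 : ρ.π a = ρ.π (∑ i, ∑ j, ev a i j • e i j) := heq (by
      simp only [map_sum, map_smul, he, Matrix.smul_single, smul_eq_mul, mul_one]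
      exact Matrix.matrix_eq_sum_single _)
    rw [h1]
    simp only [map_sum, map_smul]
  obtain ⟨i₀, hi₀⟩ : ∃ i, ρ.π (e i i) ≠ 0 := by
    by_contra! h
    obtain ⟨a, ha⟩ := ρ.ne_zero
    refine ha ?_
    rw [hsum]
    refine Finset.sum_eq_zero fun i _ => Finset.sum_eq_zero fun j _ => ?_
    rw [← hmul i i j, h, zero_mul, smul_zero]
  obtain ⟨ζ, hζ⟩ : ∃ ζ, ρ.π (e i₀ i₀) ζ ≠ 0 := by
    by_contra! h
    exact hi₀ (by ext ζ; exact h ζ)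
  set ξ : ρ.H := ((‖ρ.π (e i₀ i₀) ζ‖ : ℂ)⁻¹) • ρ.π (e i₀ i₀) ζ with hξ
  have hξ1 : ‖ξ‖ = 1 := by
    rw [hξ]
    exact norm_smul_inv_norm hζ
  have hξ2 : ρ.π (e i₀ i₀) ξ = ξ := by
    rw [hξ, map_smul, ← mul_apply_eq_comp, hmul]
  -- Moving a unit vector in the range of one diagonal unit by the units of column `i₀` gives an
  -- orthonormal family that transforms like the standard basis. Its span is invariant and
  -- finite-dimensional, hence closed and everything.
  let v : ULift.{w} (Fin n) → ρ.H := fun i => ρ.π (e i.down i₀) ξ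
  have hv : ∀ k l i, ρ.π (e k l) (v i) = if l = i.down then v ⟨k⟩ else 0 := by
    intro k l i
    change ρ.π (e k l) (ρ.π (e i.down i₀) ξ) = _
    rw [← mul_apply_eq_comp]
    split_ifs with h
    · subst h; rw [hmul]
    · rw [hmul0 _ _ _ _ h]; rfl
  have hact : ∀ a j, ρ.π a (v j) = ∑ i, ev a i.down j.down • v i := by
    intro a j
    rw [hsum, ← Equiv.ulift.{w}.symm.sum_comp]
    simp only [sum_apply, smul_apply, hv]
    simp [Finset.sum_ite_eq', Equiv.ulift]
  have hon : Orthonormal ℂ v := by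
    rw [orthonormal_iff_ite]
    intro i j
    change ⟪ρ.π (e i.down i₀) ξ, v j⟫_ℂ = _
    rw [← ContinuousLinearMap.adjoint_inner_right, ← ContinuousLinearMap.star_eq_adjoint, hstar, hv]
    have : (i.down = j.down) ↔ i = j := ULift.ext_iff.symm
    simp only [this]
    split_ifs
    · change ⟪ξ, ρ.π (e i₀ i₀) ξ⟫_ℂ = 1
      rw [hξ2, inner_self_eq_norm_sq_to_K, hξ1]; simp
    · simp
  have htop : Submodule.span ℂ (Set.range v) = ⊤ := by
    refine (ρ.irreducible _ ?_ ?_).resolve_left ?_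
    · have : FiniteDimensional ℂ (Submodule.span ℂ (Set.range v)) :=
        FiniteDimensional.span_of_finite ℂ (Set.finite_range v)
      exact Submodule.closed_of_finiteDimensional _
    · intro a η hη
      induction hη using Submodule.span_induction with
      | mem η hη =>
        obtain ⟨j, rfl⟩ := hη
        rw [hact]
        exact sum_mem fun i _ => Submodule.smul_mem _ _ (Submodule.subset_span ⟨i, rfl⟩)
      | zero => rw [map_zero]; exact zero_mem _
      | add x y _ _ hx hy => rw [map_add]; exact add_mem hx hy
      | smul r x _ hx => rw [map_smul]; exact Submodule.smul_mem _ _ hx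
    · intro h
      have h1 : v ⟨i₀⟩ ∈ Submodule.span ℂ (Set.range v) := Submodule.subset_span ⟨_, rfl⟩
      rw [h, Submodule.mem_bot] at h1
      have h2 := hon.norm_eq_one ⟨i₀⟩
      rw [h1, norm_zero] at h2
      exact zero_ne_one h2
  let b := OrthonormalBasis.mk hon htop.ge
  have hb : ∀ i, b i = v i := fun i => by simp [b]
  refine ⟨b.repr, fun a η => ?_⟩
  let f : ρ.H →ₗ[ℂ] EuclideanSpace ℂ (ULift.{w} (Fin n)) :=
    b.repr.toLinearEquiv.toLinearMap ∘ₗ (ρ.π a).toLinearMap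
  let g : ρ.H →ₗ[ℂ] EuclideanSpace ℂ (ULift.{w} (Fin n)) :=
    (matrixCLM.{w} n (ev a)).toLinearMap ∘ₗ b.repr.toLinearEquiv.toLinearMap
  have hfg : f = g := by
    refine b.toBasis.ext fun j => ?_
    change b.repr (ρ.π a (b.toBasis j)) = matrixCLM.{w} n (ev a) (b.repr (b.toBasis j))
    rw [OrthonormalBasis.coe_toBasis, b.repr_self, hb, hact]
    ext i
    rw [matrixCLM_apply, map_sum]
    simp only [map_smul, ← hb, b.repr_self]
    simp [Pi.single_apply]
  exact LinearMap.congr_fun hfg η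

/-- A homomorphism onto `M_n(ℂ)` as an irreducible representation on `ℂ ^ n`. -/
def IrreducibleRep.ofMatrixHom [NeZero n] (ev : A →⋆ₙₐ[ℂ] Matrix (Fin n) (Fin n) ℂ)
    (hev : Function.Surjective ev) : IrreducibleRep.{v, w} A where
  H := EuclideanSpace ℂ (ULift.{w} (Fin n))
  π := (matrixHom.{w} n).comp ev
  ne_zero := by
    obtain ⟨a, ha⟩ := hev 1
    refine ⟨a, fun h => ?_⟩
    have h1 : matrixCLM.{w} n (ev a) = 0 := h
    rw [ha, EmbeddingLike.map_eq_zero_iff] at h1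
    exact one_ne_zero h1
  irreducible K _ hK := by
    refine or_iff_not_imp_left.2 fun hne => ?_
    obtain ⟨ξ, hξ, hξ0⟩ := (Submodule.ne_bot_iff K).1 hne
    obtain ⟨j, hj⟩ : ∃ j, ξ j ≠ 0 := by
      by_contra! h
      exact hξ0 (by ext j; exact h j)
    refine (Submodule.eq_top_iff' (p := K)).2 fun η => ?_
    -- A matrix supported in column `j` that sends `ξ` to `η`.
    obtain ⟨a, ha⟩ := hev (Matrix.of fun i k => if k = j.down then η ⟨i⟩ * (ξ j)⁻¹ else 0)
    convert hK a ξ hξ using 1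
    change η = matrixCLM.{w} n (ev a) ξ
    rw [ha]
    ext i
    rw [matrixCLM_apply]
    have : ∀ k : ULift.{w} (Fin n), k.down = j.down ↔ k = j := fun k => ULift.ext_iff.symm
    simp [this, hj]

theorem IrreducibleRep.ofMatrixHom_apply_eq_zero_iff [NeZero n]
    (ev : A →⋆ₙₐ[ℂ] Matrix (Fin n) (Fin n) ℂ) (hev : Function.Surjective ev) (a : A) :
    (IrreducibleRep.ofMatrixHom.{v, w} ev hev).π a = 0 ↔ ev a = 0 := by
  change matrixCLM.{w} n (ev a) = 0 ↔ _
  rw [EmbeddingLike.map_eq_zero_iff]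

end MatrixRep

/-! ### The spectrum of an algebra of equivariant functions -/

section Spectrum

variable {n : ℕ} [NeZero n] {X : Type u} [TopologicalSpace X] [AddAction (ZMod n) X]
  [ContinuousConstVAdd (ZMod n) X] [LocallyCompactSpace X] [T2Space X]
  {A : Type v} [NonUnitalCStarAlgebra A]

open scoped Matrix.Norms.L2Operator in
/-- Evaluation of a transform at a point. -/
def evalHom (Φ : A →⋆ₙₐ[ℂ] C₀(X × Circle, Matrix (Fin n) (Fin n) ℂ)) (p : X × Circle) :
    A →⋆ₙₐ[ℂ] Matrix (Fin n) (Fin n) ℂ where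
  toFun a := Φ a p
  map_smul' c a := by rw [map_smul]; rfl
  map_zero' := by rw [map_zero]; rfl
  map_add' a b := by rw [map_add]; rfl
  map_mul' a b := by rw [map_mul]; rfl
  map_star' a := by rw [map_star]; rfl

namespace IsEquivariantTransform

open scoped Matrix.Norms.L2Operator

variable {Φ : A →⋆ₙₐ[ℂ] C₀(X × Circle, Matrix (Fin n) (Fin n) ℂ)} (hΦ : IsEquivariantTransform Φ)
  (hfree : ∀ (g : ZMod n) (x : X), g +ᵥ x = x → g = 0)

include hΦ hfree

/-- The irreducible representation attached to a point. -/
def irreducibleRep (p : X × Circle) : IrreducibleRep.{v, w} A :=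
  IrreducibleRep.ofMatrixHom (evalHom Φ p) (hΦ.exists_apply_eq hfree p)

/-- The point of the spectrum attached to a point. -/
def spectrumPoint (p : X × Circle) : CStarSpectrum.{v, w} A :=
  Quotient.mk _ (hΦ.irreducibleRep hfree p)

theorem mem_ker_spectrumPoint (p : X × Circle) (a : A) :
    a ∈ (hΦ.spectrumPoint.{u, v, w} hfree p).ker ↔ Φ a p = 0 := by
  change a ∈ TwoSidedIdeal.ker (hΦ.irreducibleRep.{u, v, w} hfree p).π ↔ _
  rw [TwoSidedIdeal.mem_ker]
  exact IrreducibleRep.ofMatrixHom_apply_eq_zero_iff _ _ a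

theorem mk_eq_spectrumPoint (ρ : IrreducibleRep.{v, w} A) (p : X × Circle)
    (h : ∀ a, Φ a p = 0 → ρ.π a = 0) :
    (Quotient.mk _ ρ : CStarSpectrum.{v, w} A) = hΦ.spectrumPoint hfree p :=
  Quotient.sound (ρ.exists_linearIsometryEquiv_of_ker_le (evalHom Φ p)
    (hΦ.exists_apply_eq hfree p) h)

theorem spectrumPoint_eq_iff (p q : X × Circle) :
    hΦ.spectrumPoint.{u, v, w} hfree p = hΦ.spectrumPoint hfree q ↔
      orbitMap n p = orbitMap n q := by
  constructor
  · intro h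
    by_contra hne
    obtain ⟨a, ha, ha'⟩ := hΦ.exists_apply_ne_zero hfree (isClosed_singleton (x := orbitMap n q))
      (p := p) hne
    exact ha ((hΦ.mem_ker_spectrumPoint.{u, v, w} hfree p a).1
      (h ▸ (hΦ.mem_ker_spectrumPoint hfree q a).2 (ha' q rfl)))
  · intro h
    refine hΦ.mk_eq_spectrumPoint hfree _ q fun a ha => ?_
    refine (IrreducibleRep.ofMatrixHom_apply_eq_zero_iff _ _ a).2 ?_
    exact (hΦ.vadd_eq_zero_iff a h).1 ha

theorem spectrumPoint_surjective :
    Function.Surjective (hΦ.spectrumPoint.{u, v, w} hfree) := by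
  rintro ⟨ρ⟩
  obtain ⟨p, hp⟩ := hΦ.exists_ker_le ρ
  exact ⟨p, (hΦ.mk_eq_spectrumPoint hfree ρ p hp).symm⟩

theorem isHomogeneous : IsHomogeneousCStarAlgebra.{v, w} n A := by
  intro ρ
  obtain ⟨p, hp⟩ := hΦ.exists_ker_le ρ
  obtain ⟨V, -⟩ := ρ.exists_linearIsometryEquiv_of_ker_le (evalHom Φ p)
    (hΦ.exists_apply_eq hfree p) hp
  refine ⟨Module.Finite.equiv V.symm.toLinearEquiv, ?_⟩
  rw [V.toLinearEquiv.finrank_eq]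
  simp

/-- The complement of the hull of `I` pulls back to the union of the open sets `Φ a ≠ 0`, `a ∈ I`.
Conversely, the image of an open `O` is the complement of the hull of the ideal of elements
vanishing off the orbits of `O`, as transforms separate orbits from closed sets. -/
theorem isOpenQuotientMap_spectrumPoint :
    IsOpenQuotientMap (hΦ.spectrumPoint.{u, v, w} hfree) := by
  let _ : TopologicalSpace (TwoSidedIdeal A) := Topology.lower _
  refine ⟨hΦ.spectrumPoint_surjective hfree, ?_, fun O hO => ?_⟩
  · rw [continuous_induced_rng]
    refine continuous_generateFrom_iff.2 ?_
    rintro _ ⟨I, rfl⟩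
    have : CStarSpectrum.ker ∘ hΦ.spectrumPoint.{u, v, w} hfree ⁻¹' (Set.Ici I)ᶜ =
        ⋃ a ∈ I, {p | Φ a p ≠ 0} := by
      ext p
      simp only [Set.mem_preimage, Set.mem_compl_iff, Set.mem_Ici, Set.mem_iUnion,
        Function.comp_apply, exists_prop]
      rw [← SetLike.coe_subset_coe, Set.not_subset]
      refine exists_congr fun a => and_congr_right fun _ => not_congr ?_
      exact hΦ.mem_ker_spectrumPoint hfree p a
    rw [this]
    exact isOpen_biUnion fun a _ => isOpen_ne_fun (map_continuous (Φ a)) continuous_const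
  · let I : TwoSidedIdeal A := ⨅ p : {p // orbitMap n p ∉ orbitMap n '' O},
      (hΦ.spectrumPoint.{u, v, w} hfree p).ker
    refine isOpen_induced_iff.2 ⟨(Set.Ici I)ᶜ, TopologicalSpace.isOpen_generateFrom_of_mem
      ⟨I, rfl⟩, ?_⟩
    ext σ
    obtain ⟨p, rfl⟩ := hΦ.spectrumPoint_surjective hfree σ
    have h1 : hΦ.spectrumPoint.{u, v, w} hfree p ∈ hΦ.spectrumPoint hfree '' O ↔
        orbitMap n p ∈ orbitMap n '' O := by
      simp only [Set.mem_image, hΦ.spectrumPoint_eq_iff hfree]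
    rw [h1, Set.mem_preimage, Set.mem_compl_iff, Set.mem_Ici]
    constructor
    · intro h
      by_contra hp
      exact h (iInf_le (fun p : {p // orbitMap n p ∉ orbitMap n '' O} =>
        (hΦ.spectrumPoint.{u, v, w} hfree p).ker) ⟨p, hp⟩)
    · intro hp h
      obtain ⟨a, ha, ha'⟩ := hΦ.exists_apply_ne_zero hfree
        (isOpenQuotientMap_orbitMap.isOpenMap O hO).isClosed_compl (p := p) (fun h => h hp)
      refine ha ((hΦ.mem_ker_spectrumPoint.{u, v, w} hfree p a).1 (h ?_))
      rw [TwoSidedIdeal.mem_iInf]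
      rintro ⟨q, hq⟩
      exact (hΦ.mem_ker_spectrumPoint hfree q a).2 (ha' q hq)

/-- The spectrum is the product of the orbit space and the circle. -/
def spectrumHomeomorph :
    CStarSpectrum.{v, w} A ≃ₜ AddAction.orbitRel.Quotient (ZMod n) X × Circle :=
  have h := hΦ.spectrumPoint_eq_iff.{u, v, w} hfree
  have hs := (hΦ.isOpenQuotientMap_spectrumPoint.{u, v, w} hfree)
  have ho := isOpenQuotientMap_orbitMap (n := n) (X := X)
  let f : CStarSpectrum.{v, w} A → AddAction.orbitRel.Quotient (ZMod n) X × Circle :=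
    fun σ => orbitMap n (Function.surjInv hs.surjective σ)
  have hf : ∀ p, f (hΦ.spectrumPoint hfree p) = orbitMap n p := fun p =>
    (h _ _).1 (Function.surjInv_eq hs.surjective _)
  let e : CStarSpectrum.{v, w} A ≃ AddAction.orbitRel.Quotient (ZMod n) X × Circle :=
    Equiv.ofBijective f ⟨fun σ τ hστ => by
      obtain ⟨p, rfl⟩ := hs.surjective σ
      obtain ⟨q, rfl⟩ := hs.surjective τ
      rw [hf, hf] at hστ
      exact (h p q).2 hστ, fun w => by
      obtain ⟨p, rfl⟩ := ho.surjective w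
      exact ⟨_, hf p⟩⟩
  e.toHomeomorphOfContinuousOpen
    (hs.continuous_comp_iff.1 (ho.continuous.congr fun p => (hf p).symm))
    (fun O hO => by
      have : e '' O = orbitMap n '' (hΦ.spectrumPoint hfree ⁻¹' O) := by
        ext w
        constructor
        · rintro ⟨σ, hσ, rfl⟩
          obtain ⟨p, rfl⟩ := hs.surjective σ
          exact ⟨p, hσ, (hf p).symm⟩
        · rintro ⟨p, hp, rfl⟩
          exact ⟨_, hp, hf p⟩
      rw [this]
      exact ho.isOpenMap _ (hO.preimage hs.continuous))

end IsEquivariantTransform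

end Spectrum

/-! ### The bundle of matrix algebras -/

section ConjShift

variable {n : ℕ} [NeZero n]

/-- Conjugation by the `k`-th power of the weighted cyclic shift. -/
def conjShift (z : Circle) (k : ℤ) :
    Matrix (Fin n) (Fin n) ℂ ≃⋆ₐ[ℂ] Matrix (Fin n) (Fin n) ℂ :=
  Unitary.conjStarAlgAut ℂ _ (cyclicShiftUnitary n z ^ (-k))

theorem conjShift_apply (z : Circle) (k : ℤ) (M : Matrix (Fin n) (Fin n) ℂ) :
    conjShift z k M = cyclicShift n z (-k) * M * cyclicShift n z k := by
  rw [conjShift, Unitary.conjStarAlgAut_apply, coe_cyclicShiftUnitary_zpow, star_cyclicShift,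
    neg_neg]

/-- The two powers differ by a scalar of modulus one, which cancels in the conjugation. -/
theorem conjShift_congr (z : Circle) {k l : ℤ} (h : (k : ZMod n) = l)
    (M : Matrix (Fin n) (Fin n) ℂ) : conjShift z k M = conjShift z l M := by
  obtain ⟨q, hq⟩ := (ZMod.intCast_eq_intCast_iff_dvd_sub k l n).1 h
  obtain rfl : l = k + q * n := by linear_combination hq
  rw [conjShift_apply, conjShift_apply, neg_add, ← neg_mul, cyclicShift_mul_natCast,
    cyclicShift_mul_natCast, smul_mul_assoc, smul_mul_assoc, mul_smul_comm, smul_smul,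
    ← Circle.coe_mul, ← zpow_add]
  simp

theorem conjShift_zero (z : Circle) (M : Matrix (Fin n) (Fin n) ℂ) : conjShift z 0 M = M := by
  rw [conjShift_apply, neg_zero, cyclicShift_zero, one_mul, mul_one]

theorem conjShift_add (z : Circle) (k l : ℤ) (M : Matrix (Fin n) (Fin n) ℂ) :
    conjShift z (k + l) M = conjShift z l (conjShift z k M) := by
  rw [conjShift_apply, conjShift_apply, conjShift_apply, neg_add_rev, cyclicShift_add,
    cyclicShift_add]
  simp only [mul_assoc]

theorem continuous_conjShift (k : ℤ) :
    Continuous fun p : Circle × Matrix (Fin n) (Fin n) ℂ => conjShift p.1 k p.2 := by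
  simp only [conjShift_apply]
  exact (((continuous_cyclicShift _).comp continuous_fst).matrix_mul continuous_snd).matrix_mul
    ((continuous_cyclicShift _).comp continuous_fst)

end ConjShift

/-- Points whose representative lies in `K` lie in the compact set `q '' K`; the section itself need
not be continuous. -/
theorem Function.tendsto_surjInv_cocompact {P Y : Type*} [TopologicalSpace P] [TopologicalSpace Y]
    {q : P → Y} (hq : Continuous q) (hs : Function.Surjective q) :
    Filter.Tendsto (Function.surjInv hs) (Filter.cocompact Y) (Filter.cocompact P) := by
  refine Filter.hasBasis_cocompact.tendsto_right_iff.2 fun K hK => ?_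
  filter_upwards [(hK.image hq).compl_mem_cocompact] with y hy h
  exact hy ⟨_, h, Function.surjInv_eq hs y⟩

/-! ### The bundle over the quotient and its local trivializations -/

section Bundle

variable {n : ℕ} [NeZero n] {X : Type u} [TopologicalSpace X] [AddAction (ZMod n) X]

/-- The action of `ℤ` on `X × 𝕋` through the first factor. -/
def orbitShift (n : ℕ) [AddAction (ZMod n) X] (k : ℤ) (p : X × Circle) : X × Circle :=
  ((k : ZMod n) +ᵥ p.1, p.2)

theorem orbitShift_orbitShift (k l : ℤ) (p : X × Circle) :
    orbitShift n k (orbitShift n l p) = orbitShift n (l + k) p := by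
  simp only [orbitShift, vadd_vadd, Int.cast_add, add_comm]

theorem orbitShift_zero (p : X × Circle) : orbitShift n 0 p = p := by
  simp [orbitShift]

theorem continuous_orbitShift [ContinuousConstVAdd (ZMod n) X] (k : ℤ) :
    Continuous (orbitShift n k (X := X)) :=
  ((continuous_const_vadd _).comp continuous_fst).prodMk continuous_snd

open Classical in
/-- An integer that shifts one point of an orbit to another. -/
def translation (n : ℕ) [AddAction (ZMod n) X] (p p' : X × Circle) : ℤ :=
  -- The value `0` across distinct orbits is arbitrary; conjugation by any power is still a
  -- *-automorphism.
  if h : ∃ k : ℤ, p' = orbitShift n k p then h.choose else 0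

theorem eq_orbitShift_translation {p p' : X × Circle} (h : ∃ k : ℤ, p' = orbitShift n k p) :
    p' = orbitShift n (translation n p p') p := by
  rw [translation, dif_pos h]
  exact h.choose_spec

variable (hfree : ∀ (g : ZMod n) (x : X), g +ᵥ x = x → g = 0)

include hfree

theorem intCast_eq_of_orbitShift_eq {k l : ℤ} {p : X × Circle}
    (h : orbitShift n k p = orbitShift n l p) : (k : ZMod n) = l := by
  have h1 : (k : ZMod n) +ᵥ p.1 = (l : ZMod n) +ᵥ p.1 := congrArg Prod.fst h
  refine sub_eq_zero.1 (hfree _ p.1 ?_)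
  rw [sub_eq_neg_add, ← vadd_vadd, h1, vadd_vadd, neg_add_cancel, zero_vadd]

theorem intCast_translation {p p' : X × Circle} {k : ℤ} (h : p' = orbitShift n k p) :
    ((translation n p p' : ℤ) : ZMod n) = k :=
  intCast_eq_of_orbitShift_eq hfree ((eq_orbitShift_translation ⟨k, h⟩).symm.trans h)

omit hfree in
variable (n) in
/-- The identification of the fibres over two points of an orbit. -/
def orbitTransport (p p' : X × Circle) :
    Matrix (Fin n) (Fin n) ℂ ≃⋆ₐ[ℂ] Matrix (Fin n) (Fin n) ℂ :=
  conjShift p.2 (translation n p p')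

/-- Freeness determines the translating integer mod `n`, and conjugation sees no more than that. -/
theorem orbitTransport_eq {p p' : X × Circle} {k : ℤ} (h : p' = orbitShift n k p)
    (M : Matrix (Fin n) (Fin n) ℂ) : orbitTransport n p p' M = conjShift p.2 k M :=
  conjShift_congr _ (intCast_translation hfree h) M

theorem orbitTransport_self (p : X × Circle) (M : Matrix (Fin n) (Fin n) ℂ) :
    orbitTransport n p p M = M := by
  rw [orbitTransport_eq hfree (orbitShift_zero p).symm, conjShift_zero]

theorem orbitTransport_trans {p p' p'' : X × Circle} (h : ∃ k : ℤ, p' = orbitShift n k p)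
    (h' : ∃ k : ℤ, p'' = orbitShift n k p') (M : Matrix (Fin n) (Fin n) ℂ) :
    orbitTransport n p' p'' (orbitTransport n p p' M) = orbitTransport n p p'' M := by
  obtain ⟨k, rfl⟩ := h
  obtain ⟨l, rfl⟩ := h'
  rw [orbitTransport_eq hfree (k := k) rfl, orbitTransport_eq hfree (k := l) rfl,
    orbitTransport_eq hfree (orbitShift_orbitShift l k p), conjShift_add]
  rfl

/-- The quotient map by the free action of `ℤ/n` is a local homeomorphism. -/
theorem isLocalHomeomorph_of_orbits [ContinuousConstVAdd (ZMod n) X] [LocallyCompactSpace X]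
    [T2Space X] {Y : Type v} [TopologicalSpace Y] {q : X × Circle → Y} (hq : IsOpenQuotientMap q)
    (hfib : ∀ p p', q p = q p' ↔ ∃ k : ℤ, p' = orbitShift n k p) : IsLocalHomeomorph q := by
  have : IsCancelVAdd (ZMod n) X := isCancelVAdd_iff_eq_zero_of_vadd_eq.2 hfree
  -- A free action of a finite group on such a space is properly discontinuous, so each point has a
  -- neighbourhood disjoint from its nontrivial translates.
  have hcov := isAddQuotientCoveringMap_quotientMk_of_properlyDiscontinuousVAdd (E := X)
    (G := ZMod n)
  refine isLocalHomeomorph_iff_isOpenEmbedding_restrict.2 fun p => ?_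
  obtain ⟨U, hU, hd⟩ := hcov.disjoint p.1
  obtain ⟨O, hOU, hO, hpO⟩ := mem_nhds_iff.1 hU
  have hO' : IsOpen (Prod.fst ⁻¹' O : Set (X × Circle)) := hO.preimage continuous_fst
  refine ⟨_, hO'.mem_nhds hpO, Topology.IsOpenEmbedding.of_continuous_injective_isOpenMap
    (hq.continuous.comp continuous_subtype_val) ?_ (hq.isOpenMap.comp hO'.isOpenMap_subtype_val)⟩
  rintro ⟨a, ha⟩ ⟨b, hb⟩ hab
  obtain ⟨k, rfl⟩ := (hfib a b).1 hab
  have hk := hd (k : ZMod n) ⟨_, ⟨a.1, hOU ha, rfl⟩, hOU hb⟩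
  refine Subtype.ext ?_
  simp [orbitShift, hk]

variable [ContinuousConstVAdd (ZMod n) X] [LocallyCompactSpace X]
  [T2Space X] {Y : Type v} [TopologicalSpace Y] {q : X × Circle → Y} (hq : IsOpenQuotientMap q)
  (hfib : ∀ p p', q p = q p' ↔ ∃ k : ℤ, p' = orbitShift n k p)

include hq hfib

/-- The local section of the quotient map at a point of the base. -/
def orbitChart (y : Y) : OpenPartialHomeomorph Y (X × Circle) :=
  (isLocalHomeomorph_of_orbits hfree hq hfib).localInverseAt (Function.surjInv hq.surjective y)

theorem mem_orbitChart_source (y : Y) : y ∈ (orbitChart hfree hq hfib y).source := by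
  have := (isLocalHomeomorph_of_orbits hfree hq hfib).apply_self_mem_localInverseAt_source
    (x := Function.surjInv hq.surjective y)
  rwa [Function.surjInv_eq hq.surjective] at this

theorem apply_orbitChart {i y : Y} (h : y ∈ (orbitChart hfree hq hfib i).source) :
    q (orbitChart hfree hq hfib i y) = y :=
  (isLocalHomeomorph_of_orbits hfree hq hfib).apply_localInverseAt_of_mem h

theorem orbitChart_self (y : Y) :
    orbitChart hfree hq hfib y y = Function.surjInv hq.surjective y := by
  have := (isLocalHomeomorph_of_orbits hfree hq hfib).localInverseAt_apply_self
    (x := Function.surjInv hq.surjective y)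
  rwa [Function.surjInv_eq hq.surjective] at this

theorem exists_orbitShift_orbitChart {i j y : Y} (hi : y ∈ (orbitChart hfree hq hfib i).source)
    (hj : y ∈ (orbitChart hfree hq hfib j).source) :
    ∃ k : ℤ, orbitChart hfree hq hfib j y = orbitShift n k (orbitChart hfree hq hfib i y) :=
  (hfib _ _).1 ((apply_orbitChart hfree hq hfib hi).trans (apply_orbitChart hfree hq hfib hj).symm)

omit [LocallyCompactSpace X] [T2Space X] hq hfree in
theorem apply_orbitShift (k : ℤ) (p : X × Circle) : q (orbitShift n k p) = q p :=
  ((hfib _ _).2 ⟨k, rfl⟩).symm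

/-- Two local sections differ by a locally constant shift. -/
theorem eventually_orbitChart_eq {i j y₀ : Y} {k : ℤ}
    (hi : y₀ ∈ (orbitChart hfree hq hfib i).source) (hj : y₀ ∈ (orbitChart hfree hq hfib j).source)
    (hk : orbitChart hfree hq hfib j y₀ = orbitShift n k (orbitChart hfree hq hfib i y₀)) :
    ∀ᶠ y in 𝓝 y₀, orbitChart hfree hq hfib j y = orbitShift n k (orbitChart hfree hq hfib i y) := by
  have hcont : ContinuousAt (fun y => orbitShift n k (orbitChart hfree hq hfib i y)) y₀ :=
    (continuous_orbitShift k).continuousAt.comp ((orbitChart hfree hq hfib i).continuousAt hi)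
  have hmem : ∀ᶠ y in 𝓝 y₀, orbitShift n k (orbitChart hfree hq hfib i y) ∈
      (orbitChart hfree hq hfib j).target := by
    refine hcont.eventually_mem ((orbitChart hfree hq hfib j).open_target.mem_nhds ?_)
    rw [← hk]
    exact (orbitChart hfree hq hfib j).map_source hj
  filter_upwards [hmem, (orbitChart hfree hq hfib i).open_source.mem_nhds hi,
    (orbitChart hfree hq hfib j).open_source.mem_nhds hj] with y hy hyi hyj
  -- Both points lie over `y` in the target of chart `j`, where `q` is injective.
  refine (isLocalHomeomorph_of_orbits hfree hq hfib).injOn_localInverseAt_target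
    ((orbitChart hfree hq hfib j).map_source hyj) hy ?_
  rw [apply_orbitShift hfib, apply_orbitChart hfree hq hfib hyi]
  exact apply_orbitChart hfree hq hfib hyj

theorem continuousOn_orbitTransport (i j : Y) : ContinuousOn
    (fun p : Y × Matrix (Fin n) (Fin n) ℂ =>
      orbitTransport n (orbitChart hfree hq hfib i p.1) (orbitChart hfree hq hfib j p.1) p.2)
    (((orbitChart hfree hq hfib i).source ∩ (orbitChart hfree hq hfib j).source) ×ˢ Set.univ) := by
  rintro ⟨y, M⟩ ⟨⟨hi, hj⟩, -⟩
  refine ContinuousAt.continuousWithinAt ?_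
  obtain ⟨k, hk⟩ := exists_orbitShift_orbitChart hfree hq hfib hi hj
  have hev := eventually_orbitChart_eq hfree hq hfib hi hj hk
  have h1 : ContinuousAt (fun p : Y × Matrix (Fin n) (Fin n) ℂ =>
      orbitChart hfree hq hfib i p.1) (y, M) :=
    ContinuousAt.comp (g := orbitChart hfree hq hfib i) (f := Prod.fst)
      ((orbitChart hfree hq hfib i).continuousAt hi) continuousAt_fst
  have h2 : ContinuousAt (fun p : Y × Matrix (Fin n) (Fin n) ℂ =>
      ((orbitChart hfree hq hfib i p.1).2, p.2)) (y, M) := h1.snd.prodMk continuousAt_snd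
  have hcont : ContinuousAt (fun p : Y × Matrix (Fin n) (Fin n) ℂ =>
      conjShift (orbitChart hfree hq hfib i p.1).2 k p.2) (y, M) :=
    ContinuousAt.comp (f := fun p : Y × Matrix (Fin n) (Fin n) ℂ =>
        ((orbitChart hfree hq hfib i p.1).2, p.2))
      (g := fun p : Circle × Matrix (Fin n) (Fin n) ℂ => conjShift p.1 k p.2)
      (continuous_conjShift k).continuousAt h2
  refine hcont.congr ?_
  have hev' : ∀ᶠ p : Y × Matrix (Fin n) (Fin n) ℂ in 𝓝 (y, M),
      orbitChart hfree hq hfib j p.1 = orbitShift n k (orbitChart hfree hq hfib i p.1) :=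
    (continuousAt_fst (p := (y, M))).eventually hev
  filter_upwards [hev'] with p hp
  exact (orbitTransport_eq hfree hp p.2).symm

/-- The bundle over the quotient associated with the conjugation action on matrices. -/
def orbitBundle : MatrixBundle Y Y n where
  baseSet y := (orbitChart hfree hq hfib y).source
  isOpen_baseSet y := (orbitChart hfree hq hfib y).open_source
  indexAt := id
  mem_baseSet_at := mem_orbitChart_source hfree hq hfib
  coordChange i j y := orbitTransport n (orbitChart hfree hq hfib i y) (orbitChart hfree hq hfib j y)
  coordChange_self _ _ _ M := orbitTransport_self hfree _ M
  continuousOn_coordChange := continuousOn_orbitTransport hfree hq hfib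
  coordChange_comp _ _ _ _ h M :=
    orbitTransport_trans hfree (exists_orbitShift_orbitChart hfree hq hfib h.1.1 h.1.2)
      (exists_orbitShift_orbitChart hfree hq hfib h.1.2 h.2) M
  coordChange_starAlg _ _ _ _ := ⟨orbitTransport n _ _, fun _ => rfl⟩

/-- The preferred chart at `y` sends `y` to its chosen representative, so the fibre over `y` is read
at that representative. -/
theorem isContinuousSection_orbitBundle_iff (s : Y → Matrix (Fin n) (Fin n) ℂ) :
    (orbitBundle hfree hq hfib).IsContinuousSection s ↔ ∀ y₀, ContinuousAt
      (fun y => orbitTransport n (Function.surjInv hq.surjective y)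
        (orbitChart hfree hq hfib y₀ y) (s y)) y₀ := by
  rw [MatrixBundle.isContinuousSection_iff]
  refine forall_congr' fun y₀ => ?_
  have : (fun y => (orbitBundle hfree hq hfib).coordChange
      ((orbitBundle hfree hq hfib).indexAt y) ((orbitBundle hfree hq hfib).indexAt y₀) y (s y)) =
      fun y => orbitTransport n (Function.surjInv hq.surjective y)
        (orbitChart hfree hq hfib y₀ y) (s y) := by
    ext1 y
    rw [← orbitChart_self hfree hq hfib y]
    rfl
  rw [this]

/-- The preimage of a compact set under the quotient map is contained in a compact set. -/
theorem exists_isCompact_preimage_subset {L : Set Y} (hL : IsCompact L) :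
    ∃ K, IsCompact K ∧ q ⁻¹' L ⊆ K := by
  refine hL.induction_on (p := fun S => ∃ K, IsCompact K ∧ q ⁻¹' S ⊆ K) ⟨∅, isCompact_empty, by simp⟩
    (fun S T hST ⟨K, hK, h⟩ => ⟨K, hK, (Set.preimage_mono hST).trans h⟩)
    (fun S T ⟨K, hK, h⟩ ⟨K', hK', h'⟩ => ⟨K ∪ K', hK.union hK', Set.union_subset_union h h'⟩) ?_
  intro y _
  obtain ⟨p, rfl⟩ := hq.surjective y
  obtain ⟨K, hK, hpK⟩ := exists_compact_mem_nhds p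
  -- The full preimage of `q '' K` is the union of the `n` translates of `K`.
  refine ⟨q '' K, mem_nhdsWithin_of_mem_nhds (hq.isOpenMap.image_mem_nhds hpK),
    ⋃ i : Fin n, orbitShift n ((i : ℕ) : ℤ) '' K,
    isCompact_iUnion fun i => hK.image (continuous_orbitShift _), ?_⟩
  rintro p' ⟨p₁, hp₁, h⟩
  obtain ⟨k, rfl⟩ := (hfib p₁ p').1 h
  obtain ⟨i, hi⟩ := Fin.exists_intCast_dvd (n := n) (-k)
  refine Set.mem_iUnion.2 ⟨i, p₁, hp₁, ?_⟩
  have hki : (k : ZMod n) = (((i : ℕ) : ℤ) : ZMod n) :=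
    (ZMod.intCast_eq_intCast_iff_dvd_sub k _ n).2 (hi.trans (dvd_of_eq (by ring)))
  rw [orbitShift, orbitShift, hki]

theorem tendsto_cocompact_of_orbits : Filter.Tendsto q (Filter.cocompact _) (Filter.cocompact Y) := by
  refine Filter.hasBasis_cocompact.tendsto_right_iff.2 fun L hL => ?_
  obtain ⟨K, hK, hKL⟩ := exists_isCompact_preimage_subset hfree hq hfib hL
  filter_upwards [hK.compl_mem_cocompact] with p hp h
  exact hp (hKL h)

end Bundle

/-! ### The isomorphism with the algebra of sections -/

section Sections

open scoped Matrix.Norms.L2Operator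

variable {n : ℕ} [NeZero n] {X : Type u} [TopologicalSpace X] [AddAction (ZMod n) X]
  [ContinuousConstVAdd (ZMod n) X] [LocallyCompactSpace X] [T2Space X]
  (hfree : ∀ (g : ZMod n) (x : X), g +ᵥ x = x → g = 0)
  {Y : Type w} [TopologicalSpace Y] {q : X × Circle → Y} (hq : IsOpenQuotientMap q)
  (hfib : ∀ p p', q p = q p' ↔ ∃ k : ℤ, p' = orbitShift n k p)

theorem norm_conjShift (z : Circle) (k : ℤ) (M : Matrix (Fin n) (Fin n) ℂ) :
    ‖conjShift z k M‖ = ‖M‖ := by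
  rw [conjShift_apply, norm_mul_cyclicShift, norm_cyclicShift_mul]

theorem norm_orbitTransport (p p' : X × Circle) (M : Matrix (Fin n) (Fin n) ℂ) :
    ‖orbitTransport n p p' M‖ = ‖M‖ :=
  norm_conjShift _ _ M

include hfib in
theorem exists_orbitShift_surjInv (p : X × Circle) :
    ∃ k : ℤ, p = orbitShift n k (Function.surjInv hq.surjective (q p)) :=
  (hfib _ _).1 (Function.surjInv_eq hq.surjective (q p))

/-- The equivariant function on the covering space attached to a section over the quotient. -/
def liftSection (hq : IsOpenQuotientMap q) (t : Y → Matrix (Fin n) (Fin n) ℂ) (p : X × Circle) :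
    Matrix (Fin n) (Fin n) ℂ :=
  orbitTransport n (Function.surjInv hq.surjective (q p)) p (t (q p))

include hfree hfib

theorem liftSection_surjInv (t : Y → Matrix (Fin n) (Fin n) ℂ) (y : Y) :
    liftSection hq t (Function.surjInv hq.surjective y) = t y := by
  rw [liftSection, Function.surjInv_eq hq.surjective, orbitTransport_self hfree]

theorem liftSection_orbitShift (t : Y → Matrix (Fin n) (Fin n) ℂ) (k : ℤ) (p : X × Circle) :
    liftSection hq t (orbitShift n k p) = conjShift p.2 k (liftSection hq t p) := by
  rw [← orbitTransport_eq hfree (p := p) (k := k) rfl, liftSection, liftSection,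
    orbitTransport_trans hfree (exists_orbitShift_surjInv hq hfib p) ⟨k, rfl⟩,
    ← (hfib p _).2 ⟨k, rfl⟩]

/-- Near the representative of `y`, the chart at `y` inverts `q`, so the lift is the section read in
that chart, composed with `q`. -/
theorem continuousAt_liftSection_surjInv {t : Y → Matrix (Fin n) (Fin n) ℂ}
    (ht : (orbitBundle hfree hq hfib).IsContinuousSection t) (y : Y) :
    ContinuousAt (liftSection hq t) (Function.surjInv hq.surjective y) := by
  have h1 := (isContinuousSection_orbitBundle_iff hfree hq hfib t).1 ht y
  have hy : q (Function.surjInv hq.surjective y) = y := Function.surjInv_eq hq.surjective y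
  have h2 : ContinuousAt (fun p => orbitTransport n (Function.surjInv hq.surjective (q p))
      (orbitChart hfree hq hfib y (q p)) (t (q p))) (Function.surjInv hq.surjective y) :=
    ContinuousAt.comp (f := q) (g := fun y' => orbitTransport n
      (Function.surjInv hq.surjective y') (orbitChart hfree hq hfib y y') (t y'))
      (by rwa [hy]) hq.continuous.continuousAt
  refine h2.congr ?_
  have hmem : Function.surjInv hq.surjective y ∈ (orbitChart hfree hq hfib y).target := by
    rw [← orbitChart_self hfree hq hfib y]
    exact (orbitChart hfree hq hfib y).map_source (mem_orbitChart_source hfree hq hfib y)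
  filter_upwards [(orbitChart hfree hq hfib y).open_target.mem_nhds hmem] with p hp
  have hpq : orbitChart hfree hq hfib y (q p) = p := by
    obtain ⟨y', hy', rfl⟩ : ∃ y' ∈ (orbitChart hfree hq hfib y).source,
        orbitChart hfree hq hfib y y' = p :=
      ⟨_, (orbitChart hfree hq hfib y).map_target hp, (orbitChart hfree hq hfib y).right_inv hp⟩
    rw [apply_orbitChart hfree hq hfib hy']
  rw [hpq, liftSection]

/-- Every point is a shift of a chosen representative, and equivariance carries continuity along the
orbit. -/
theorem continuous_liftSection {t : Y → Matrix (Fin n) (Fin n) ℂ}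
    (ht : (orbitBundle hfree hq hfib).IsContinuousSection t) :
    Continuous (liftSection hq t) := by
  refine continuous_iff_continuousAt.2 fun p => ?_
  obtain ⟨k, hk⟩ := (hfib p _).1 (Function.surjInv_eq hq.surjective (q p)).symm
  have h1 : ContinuousAt (liftSection hq t) (orbitShift n k p) :=
    hk ▸ continuousAt_liftSection_surjInv hfree hq hfib ht (q p)
  have h2 : ContinuousAt (fun p' => liftSection hq t (orbitShift n k p')) p :=
    ContinuousAt.comp (f := orbitShift n k) h1 (continuous_orbitShift k).continuousAt
  have h3 : ContinuousAt (fun p' : X × Circle =>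
      conjShift p'.2 (-k) (liftSection hq t (orbitShift n k p'))) p :=
    ContinuousAt.comp (f := fun p' : X × Circle => (p'.2, liftSection hq t (orbitShift n k p')))
      (g := fun r : Circle × Matrix (Fin n) (Fin n) ℂ => conjShift r.1 (-k) r.2)
      (continuous_conjShift (-k)).continuousAt (continuousAt_snd.prodMk h2)
  refine h3.congr (Filter.Eventually.of_forall fun p' => ?_)
  beta_reduce
  rw [liftSection_orbitShift hfree hq hfib, ← conjShift_add, add_neg_cancel, conjShift_zero]

theorem tendsto_liftSection {t : Y → Matrix (Fin n) (Fin n) ℂ}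
    (ht : Filter.Tendsto t (Filter.cocompact Y) (𝓝 0)) :
    Filter.Tendsto (liftSection hq t) (Filter.cocompact _) (𝓝 0) := by
  rw [tendsto_zero_iff_norm_tendsto_zero] at ht ⊢
  refine (ht.comp (tendsto_cocompact_of_orbits hfree hq hfib)).congr fun p => ?_
  exact (norm_orbitTransport _ _ _).symm

namespace IsEquivariantTransform

variable {A : Type v} [NonUnitalCStarAlgebra A]
  {Φ : A →⋆ₙₐ[ℂ] C₀(X × Circle, Matrix (Fin n) (Fin n) ℂ)} (hΦ : IsEquivariantTransform Φ)

include hΦ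

omit [LocallyCompactSpace X] [T2Space X] hfib in
theorem orbitTransport_apply (a : A) {p p' : X × Circle} (h : ∃ k : ℤ, p' = orbitShift n k p) :
    orbitTransport n p p' (Φ a p) = Φ a p' := by
  obtain ⟨k, rfl⟩ := h
  rw [orbitTransport_eq hfree (k := k) rfl, conjShift_apply, orbitShift, hΦ.vadd]

/-- Transport along orbits matches the values of `Φ a`, so in a chart the section becomes `Φ a`
composed with a local inverse of `q`. -/
theorem isContinuousSection (a : A) : (orbitBundle hfree hq hfib).IsContinuousSection
    fun y => Φ a (Function.surjInv hq.surjective y) := by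
  rw [isContinuousSection_orbitBundle_iff]
  intro y
  have h1 : ContinuousAt (fun y' => Φ a (orbitChart hfree hq hfib y y')) y :=
    (map_continuous (Φ a)).continuousAt.comp
      ((orbitChart hfree hq hfib y).continuousAt (mem_orbitChart_source hfree hq hfib y))
  refine h1.congr ?_
  filter_upwards [(orbitChart hfree hq hfib y).open_source.mem_nhds
    (mem_orbitChart_source hfree hq hfib y)] with y' hy'
  refine (hΦ.orbitTransport_apply hfree a ((hfib _ _).1 ?_)).symm
  rw [Function.surjInv_eq hq.surjective, apply_orbitChart hfree hq hfib hy']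

/-- The transform as a homomorphism to the algebra of sections. -/
def sectionHom : A →⋆ₙₐ[ℂ] (orbitBundle hfree hq hfib).sections where
  toFun a := ⟨fun y => Φ a (Function.surjInv hq.surjective y),
    hΦ.isContinuousSection hfree hq hfib a,
    (zero_at_infty (Φ a)).comp (Function.tendsto_surjInv_cocompact hq.continuous hq.surjective)⟩
  map_smul' c a := Subtype.ext <| funext fun _ => map_smul (evalHom Φ _) c a
  map_zero' := Subtype.ext <| funext fun _ => map_zero (evalHom Φ _)
  map_add' a b := Subtype.ext <| funext fun _ => map_add (evalHom Φ _) a b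
  map_mul' a b := Subtype.ext <| funext fun _ => map_mul (evalHom Φ _) a b
  map_star' a := Subtype.ext <| funext fun _ => map_star (evalHom Φ _) a

theorem sectionHom_apply (a : A) (y : Y) :
    (hΦ.sectionHom hfree hq hfib a : Y → Matrix (Fin n) (Fin n) ℂ) y =
      Φ a (Function.surjInv hq.surjective y) :=
  rfl

theorem bijective_sectionHom : Function.Bijective (hΦ.sectionHom hfree hq hfib) := by
  refine ⟨fun a b hab => hΦ.ext fun p => ?_, fun ⟨t, ht, ht'⟩ => ?_⟩
  · have h := congrFun (congrArg Subtype.val hab) (q p)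
    rw [sectionHom_apply, sectionHom_apply] at h
    have hp := exists_orbitShift_surjInv hq hfib p
    rw [← hΦ.orbitTransport_apply hfree a hp, ← hΦ.orbitTransport_apply hfree b hp, h]
  · obtain ⟨a, ha⟩ := hΦ.exists_eq
      ⟨⟨liftSection hq t, continuous_liftSection hfree hq hfib ht⟩,
        tendsto_liftSection hfree hq hfib ht'⟩
      (fun x z k => (liftSection_orbitShift hfree hq hfib t k (x, z)).trans (conjShift_apply _ _ _))
    refine ⟨a, Subtype.ext (funext fun y => ?_)⟩
    rw [sectionHom_apply, ha]
    exact liftSection_surjInv hfree hq hfib t y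

omit hfib

/-- The bundle is formed directly over the spectrum, with `spectrumPoint` as quotient map.
Evaluation at `σ` is then `Φ` at a representative of `σ`, whose kernel is that of `σ`. -/
theorem isLocallyTrivialHomogeneous : IsLocallyTrivialHomogeneous.{v, w} n A := by
  have hq := hΦ.isOpenQuotientMap_spectrumPoint.{u, v, w} hfree
  have hfib : ∀ p p', hΦ.spectrumPoint.{u, v, w} hfree p = hΦ.spectrumPoint hfree p' ↔
      ∃ k : ℤ, p' = orbitShift n k p := fun p p' =>
    (hΦ.spectrumPoint_eq_iff hfree p p').trans orbitMap_eq_iff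
  refine ⟨hΦ.isHomogeneous hfree, _, orbitBundle hfree hq hfib,
    StarAlgEquiv.ofBijective (hΦ.sectionHom hfree hq hfib)
      (hΦ.bijective_sectionHom hfree hq hfib), fun a σ => ?_⟩
  have h := hΦ.mem_ker_spectrumPoint.{u, v, w} hfree (Function.surjInv hq.surjective σ) a
  rw [Function.surjInv_eq hq.surjective] at h
  exact h.symm

end IsEquivariantTransform

end Sections

end

theorem mainTheorem6 {X : Type u} [TopologicalSpace X] [LocallyCompactSpace X] [T2Space X]
    (n : ℕ) [NeZero n] [AddAction (ZMod n) X] [ContinuousConstVAdd (ZMod n) X]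
    (hfree : ∀ (g : ZMod n) (x : X), g +ᵥ x = x → g = 0) :
    IsLocallyTrivialHomogeneous.{u + 1, w} n
        (crossedProduct (Homeomorph.vadd (1 : ZMod n) : X ≃ₜ X).c0Aut) ∧
      Nonempty (CStarSpectrum.{u + 1, w}
          (crossedProduct (Homeomorph.vadd (1 : ZMod n) : X ≃ₜ X).c0Aut) ≃ₜ
        AddAction.orbitRel.Quotient (ZMod n) X × Circle) :=
  ⟨isEquivariantTransform_evHom.isLocallyTrivialHomogeneous hfree,
    ⟨isEquivariantTransform_evHom.spectrumHomeomorph hfree⟩⟩
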